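/- **Notation.** Let $\Delta=\{(u,v):0\le v\le u\}$ with the metric $|u-u'|+|v-v'|$; $\log$ is to base $2$. For $0\le\alpha<\infty$, $\mathcal B(\alpha)$ is the set of $\alpha$-Lipschitz functions $\psi:\Delta\to[0,\infty)$ such that $\psi(u,u)=0$, $\psi(u,v)\le\psi(u,w)+\psi(w,v)$, $\psi(w,v)\le\psi(u,v)$ and $\psi(u,w)\le\psi(u,v)$ for all $0\le v\le w\le u$. For $0\le h\le\alpha$, $\overline{\mathcal B}_h(\alpha)$ is the set of $\psi\in\mathcal B(\alpha)$ with $\psi(u+z,v+z)\ge\psi(u,v)$ for $(u,v)\in\Delta$, $z\ge0$, and $\psi(u,0)-\psi(v,0)\ge h(u-v)$ for $(u,v)\in\Delta$. For $\psi\in\mathcal B(\alpha)$ put $$\Phi_h(\psi)(u,v)=\max_{0\le z\le u}\begin{cases}\psi(u-z,v-z)&:0\le z\le v,\\ h(z-v)+\psi(u-z,0)&:v\le z\le u.\end{cases}$$ For a non-empty metric space $E$, $N_r(S)$ is the least number of open balls of radius $r$ (centred in $E$) covering $S\subset E$, and $\beta_E(u,v)=\log\sup_{x\in E}N_{2^{-u}}(B(x,2^{-v}))$;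 subsets of a metric space are regarded as metric spaces. The quasi-Assouad dimension is $$\dim_{\mathrm{qA}}E=\lim_{\theta\nearrow1}\inf\Bigl\{s\ge0:\exists C>0\ \forall\,0<r\le r^\theta\le R<1,\ \sup_{x\in E}N_r(B(x,R))\le C(R/r)^s\Bigr\}.$$ An error function is an increasing $\eta:[0,\infty)\to[0,\infty)$ with $\eta(u)/u\to0$ as $u\to\infty$. A function $\psi$ on $\Delta$ is an approximate two-scale branching function of $E$ if $|\beta_E(u,v)-\psi(u,v)|\le\eta(u)$ on $\Delta$ for some error function $\eta$. Let $X$ be a compact metric space and $\{f_i\}_{i\in\mathcal I}$ a finite non-empty family of strict Lipschitz contractions $X\to X$. For a finite word $\mathtt i=(i_1,\dots,i_n)\in\mathcal I^*$ let $f_{\mathtt i}=f_{i_1}\circ\cdots\circ f_{i_n}$, and let $\mathtt i^-$ be $\mathtt i$ without its last letter. For a non-empty compact $F\subset X$, the inhomogeneous attractor with condensation set $F$ is the non-empty compact $\Lambda\subset X$ with $\Lambda=F\cup\bigcup_{i\in\mathcal I}f_i(\Lambda)$. The family is *minimally distorting* with respect to $\rho:\mathcal I^*\to[0,\infty)$ if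 $\rho(\varnothing)=0$, $\rho(\mathtt i)>0$ for $\mathtt i\ne\varnothing$, there is $A\ge0$ with $0\le\rho(\mathtt i\mathtt j)-\rho(\mathtt i)-\rho(\mathtt j)\le A$ for all $\mathtt i,\mathtt j\in\mathcal I^*$, and there is an error function $\eta$ such that for all $\mathtt i\in\mathcal I^*$, writing $z=\rho(\mathtt i)$, $$\bigl|\beta_{f_{\mathtt i}(F)}(u+z,v+z)-\beta_F(u,v)\bigr|\le\eta(u+z)\quad\text{for all }(u,v)\in\Delta,\qquad \operatorname{diam}f_{\mathtt i}(X)\le2^{-z+\eta(z)}.$$ Let $\mathcal I^*(u)=\{\mathtt i\in\mathcal I^*:\rho(\mathtt i^-)<u\le\rho(\mathtt i)\}$. The family is *asymptotically bounded* if $\frac1u\log\sup_{x\in X}\#\{\mathtt i\in\mathcal I^*(u):f_{\mathtt i}(X)\cap B(x,2^{-u})\ne\varnothing\}\to0$ as $u\to\infty$, and its *critical exponent* is $h=\lim_{u\to\infty}\frac1u\log\#\mathcal I^*(u)$. **Theorem.** (1) Let $0\le h\le\alpha<\infty$. For every $\beta\in\mathcal B(\alpha)$ the maximum defining $\Phi_h(\beta)$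 is attained, $\Phi_h(\beta)\in\overline{\mathcal B}_h(\alpha)$, and $\Phi_h(\beta)$ is the least element of $\{\xi\in\overline{\mathcal B}_h(\alpha):\xi\ge\beta\}$, so that $$\Phi_h(\beta)=\inf\{\xi\in\overline{\mathcal B}_h(\alpha):\xi\ge\beta\}\quad\text{pointwise}.$$ In particular $\Phi_h:\mathcal B(\alpha)\to\overline{\mathcal B}_h(\alpha)$ is surjective, idempotent, and the identity on $\overline{\mathcal B}_h(\alpha)$. (2) Let $X$ be a compact metric space with $\dim_{\mathrm{qA}}X=\alpha<\infty$, let $F\subset X$ be non-empty and compact, and let $\Lambda$ be an inhomogeneous attractor with condensation set $F$ whose family of maps is minimally distorting with respect to some $\rho$ and, with the same $\rho$, asymptotically bounded. Then the critical exponent $h$ exists and $0\le h\le\alpha$, and for every approximate two-scale branching function $\psi\in\mathcal B(\alpha)$ of $F$, the function $\Phi_h(\psi)$ is an approximate two-scale branching function of $\Lambda$; that is, $\beta_\Lambda(u,v)=\Phi_h(\psi)(u,v)+o(u)$ uniformly in $v$. -/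

import Mathlib

open Set Filter Topology
open scoped ENNReal NNReal

namespace TwoScaleBranching

noncomputable section

/-! ### The domain and the spaces of two-scale branching functions -/

/-- The set `Δ` of pairs `(u, v)` with `0 ≤ v ≤ u`. -/
abbrev Delta : Type := {p : ℝ × ℝ // 0 ≤ p.2 ∧ p.2 ≤ p.1}

/-- The space `𝓑(α)` for finite `α`: increasing in the first variable, decreasing in the second,
zero on the diagonal, subadditive, and `α`-Lipschitz for the `L¹` metric on `Δ`. Such a function
is finite everywhere, being Lipschitz and zero on the diagonal, so real values suffice. -/
structure IsB (α : ℝ) (ψ : Delta → ℝ) : Prop where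
  nonneg : ∀ p, 0 ≤ ψ p
  diag : ∀ (u : ℝ) (hu : 0 ≤ u), ψ ⟨(u, u), hu, le_refl u⟩ = 0
  subadd : ∀ (v w u : ℝ) (hv : 0 ≤ v) (hvw : v ≤ w) (hwu : w ≤ u),
    ψ ⟨(u, v), hv, hvw.trans hwu⟩ ≤ ψ ⟨(u, w), hv.trans hvw, hwu⟩ + ψ ⟨(w, v), hv, hvw⟩
  mono_left : ∀ (v w u : ℝ) (hv : 0 ≤ v) (hvw : v ≤ w) (hwu : w ≤ u),
    ψ ⟨(w, v), hv, hvw⟩ ≤ ψ ⟨(u, v), hv, hvw.trans hwu⟩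
  anti_right : ∀ (v w u : ℝ) (hv : 0 ≤ v) (hvw : v ≤ w) (hwu : w ≤ u),
    ψ ⟨(u, w), hv.trans hvw, hwu⟩ ≤ ψ ⟨(u, v), hv, hvw.trans hwu⟩
  lipschitz : ∀ p q : Delta,
    |ψ p - ψ q| ≤ α * (|p.1.1 - q.1.1| + |p.1.2 - q.1.2|)

/-- The space `𝓑(α)` as a set of functions on `Δ`. -/
def B (α : ℝ) : Set (Delta → ℝ) := {ψ | IsB α ψ}

/-- The monotone subspace `𝓑̄_h(α)` of `𝓑(α)`. -/
def Bbar (h α : ℝ) : Set (Delta → ℝ) :=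
  {ψ | ψ ∈ B α ∧
    (∀ (u v z : ℝ) (hv : 0 ≤ v) (hvu : v ≤ u) (hz : 0 ≤ z),
      ψ ⟨(u, v), hv, hvu⟩ ≤ ψ ⟨(u + z, v + z), add_nonneg hv hz, add_le_add_left hvu z⟩) ∧
    (∀ (u v : ℝ) (hv : 0 ≤ v) (hvu : v ≤ u),
      h * (u - v) ≤ ψ ⟨(u, 0), le_refl 0, hv.trans hvu⟩ - ψ ⟨(v, 0), le_refl 0, hv⟩)}

/-- The quantities over which the maximum is taken in `Φ_h(ψ)(u, v)`: the numbers
`ψ(u - z, v - z)` for `0 ≤ z ≤ v` and `h (z - v) + ψ(u - z, 0)` for `v ≤ z ≤ u`. -/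
def PhiValues (h : ℝ) (ψ : Delta → ℝ) (p : Delta) : Set ℝ :=
  {t | ∃ (z : ℝ) (_ : 0 ≤ z) (hzv : z ≤ p.1.2),
    t = ψ ⟨(p.1.1 - z, p.1.2 - z), sub_nonneg.2 hzv, sub_le_sub_right p.2.2 z⟩} ∪
  {t | ∃ (z : ℝ) (_ : p.1.2 ≤ z) (hzu : z ≤ p.1.1),
    t = h * (z - p.1.2) + ψ ⟨(p.1.1 - z, 0), le_refl 0, sub_nonneg.2 hzu⟩}

/-- The map `Φ_h`. -/
def Phi (h : ℝ) (ψ : Delta → ℝ) : Delta → ℝ := fun p => sSup (PhiValues h ψ p)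

/-! ### Covering numbers, the two-scale branching function and the quasi-Assouad dimension -/

/-- `N_r(S)`: the least number of open balls of radius `r` needed to cover the subset `S` of the
metric space `E` (with centres in `E`), and `∞` if no finite number suffices. -/
def coverNum {E : Type*} [MetricSpace E] (r : ℝ) (S : Set E) : ℕ∞ :=
  sInf {n | ∃ t : Finset E, S ⊆ (⋃ x ∈ t, Metric.ball x r) ∧ n = (t.card : ℕ∞)}

/-- The two-scale branching function `β_E(u, v)`, the logarithm to base 2 of
`sup_x N_{2^{-u}}(B(x, 2^{-v}))`. A subset of a metric space is regarded as a metric space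
in its own right. -/
def branching (E : Type*) [MetricSpace E] (u v : ℝ) : EReal :=
  ENNReal.log (⨆ x : E, (coverNum ((2 : ℝ) ^ (-u)) (Metric.ball x ((2 : ℝ) ^ (-v))) : ℝ≥0∞)) /
    ((Real.log 2 : ℝ) : EReal)

/-- The infimum, for a fixed `θ`, of the exponents `s ≥ 0` such that for some `C > 0`, whenever
`0 < r ≤ r ^ θ ≤ R < 1`, every ball of radius `R` can be covered by `C (R / r) ^ s` balls of
radius `r`; it is `∞` if there is no such exponent. -/
def quasiAssouadAt (E : Type*) [MetricSpace E] (θ : ℝ) : ℝ≥0∞ :=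
  sInf {a | ∃ s : ℝ, 0 ≤ s ∧ a = ENNReal.ofReal s ∧ ∃ C : ℝ, 0 < C ∧
    ∀ r R : ℝ, 0 < r → r ≤ r ^ θ → r ^ θ ≤ R → R < 1 → ∀ x : E,
      (coverNum r (Metric.ball x R) : ℝ≥0∞) ≤ ENNReal.ofReal (C * (R / r) ^ s)}

/-- The quasi-Assouad dimension of `E` equals the finite number `α`. -/
def HasQuasiAssouadDim (E : Type*) [MetricSpace E] (α : ℝ) : Prop :=
  0 ≤ α ∧ Tendsto (quasiAssouadAt E) (𝓝[<] 1) (𝓝 (ENNReal.ofReal α))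

/-- Error functions: increasing functions `η : [0, ∞) → [0, ∞)` with `η(u) / u → 0`. -/
structure IsErrorFunction (η : ℝ → ℝ) : Prop where
  nonneg : ∀ u, 0 ≤ u → 0 ≤ η u
  mono : MonotoneOn η (Ici 0)
  tendsto : Tendsto (fun u => η u / u) atTop (𝓝 0)

/-- `|a - b| ≤ e` for extended reals `a`, `b`. -/
def Within (a b : EReal) (e : ℝ) : Prop := a ≤ b + (e : EReal) ∧ b ≤ a + (e : EReal)

/-- `ψ` is an approximate two-scale branching function of `E`:
`β_E(u, v) = ψ(u, v) + o(u)`, uniformly in `v`. -/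
def IsApproxBranching (E : Type*) [MetricSpace E] (ψ : Delta → ℝ) : Prop :=
  ∃ η, IsErrorFunction η ∧
    ∀ p : Delta, Within (branching E p.1.1 p.1.2) ((ψ p : ℝ) : EReal) (η p.1.1)

/-! ### Inhomogeneous attractors -/

/-- The composition `f_{i₁} ∘ ⋯ ∘ f_{iₙ}` along a finite word. -/
def wordMap {X I : Type*} (f : I → X → X) : List I → X → X
  | [] => id
  | i :: w => f i ∘ wordMap f w

/-- `Λ` is the inhomogeneous attractor of the maps `f i` with condensation set `F`. -/
structure IsInhomogeneousAttractor {X I : Type*} [MetricSpace X]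
    (f : I → X → X) (F Λ : Set X) : Prop where
  nonempty : Λ.Nonempty
  isCompact : IsCompact Λ
  invariant : Λ = F ∪ ⋃ i, f i '' Λ

/-- `g : Y → Z` is `(η, z)`-contracting: it is a Lipschitz contraction of `Y` onto `Z` and, when
the metric `d` of `Z` is replaced by `2 ^ z * d`, the branching functions of `Y` and `Z` differ by
at most `η (u + z)`. The balls of radius `2 ^ (-u)` for `2 ^ z * d` are the balls of radius
`2 ^ (-(u + z))` for `d`, so the branching function for the new metric at `(u, v)` is
`branching Z (u + z) (v + z)`. -/
structure IsContracting {Y Z : Type*} [MetricSpace Y] [MetricSpace Z]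
    (η : ℝ → ℝ) (z : ℝ) (g : Y → Z) : Prop where
  surjective : Function.Surjective g
  lipschitz : LipschitzWith 1 g
  uniform : ∀ u v : ℝ, 0 ≤ v → v ≤ u →
    Within (branching Z (u + z) (v + z)) (branching Y u v) (η (u + z))

/-- The maps `f i` are minimally distorting on `F` with respect to `ρ`. The last clause makes
explicit that the composition along `w` contracts by `2 ^ (-ρ w)`, up to the admitted error. -/
structure IsMinimallyDistorting {X I : Type*} [MetricSpace X]
    (f : I → X → X) (F : Set X) (ρ : List I → ℝ) : Prop where
  nil : ρ [] = 0
  pos : ∀ w, w ≠ [] → 0 < ρ w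
  almost_additive : ∃ A : ℝ, 0 ≤ A ∧ ∀ w w' : List I,
    0 ≤ ρ (w ++ w') - (ρ w + ρ w') ∧ ρ (w ++ w') - (ρ w + ρ w') ≤ A
  contracting : ∃ η, IsErrorFunction η ∧ ∀ w : List I,
    IsContracting η (ρ w) (F.imageFactorization (wordMap f w)) ∧
    ∀ x y : X, dist (wordMap f w x) (wordMap f w y) ≤ (2 : ℝ) ^ (η (ρ w) - ρ w)

/-- The set `𝓘*(u)` of words `w` with `ρ(w⁻) < u ≤ ρ(w)`, where `w⁻` is `w` without its
last letter. -/
def cutSet {I : Type*} (ρ : List I → ℝ) (u : ℝ) : Set (List I) :=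
  {w | ρ w.dropLast < u ∧ u ≤ ρ w}

/-- The set `𝓕(x, u)` of words in `𝓘*(u)` whose cylinder meets `B(x, 2^{-u})`. -/
def cutSetNear {X I : Type*} [MetricSpace X] (f : I → X → X) (ρ : List I → ℝ)
    (x : X) (u : ℝ) : Set (List I) :=
  {w | w ∈ cutSet ρ u ∧ (range (wordMap f w) ∩ Metric.ball x ((2 : ℝ) ^ (-u))).Nonempty}

/-- `h` is the critical exponent, the limit of `log #𝓘*(u) / u`. The sets `𝓘*(u)` with `u > 0` are
finite for minimally distorting maps, as then `ρ` grows at least linearly in the word length. -/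
def IsCriticalExponent {I : Type*} (ρ : List I → ℝ) (h : ℝ) : Prop :=
  Tendsto (fun u : ℝ => Real.logb 2 ((cutSet ρ u).ncard : ℝ) / u) atTop (𝓝 h)

/-- Asymptotic boundedness: `log (sup_x #𝓕(x, u)) / u → 0`. -/
def IsAsymptoticallyBounded {X I : Type*} [MetricSpace X] (f : I → X → X)
    (ρ : List I → ℝ) : Prop :=
  Tendsto (fun u : ℝ => Real.logb 2 (⨆ x : X, ((cutSetNear f ρ x u).ncard : ℝ)) / u)
    atTop (𝓝 0)

end

end TwoScaleBranching

open TwoScaleBranching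

/-!
The first half is a direct verification: every shift `z` that competes for `Φ_h(β)(u, v)` has a
counterpart competing for the right-hand side of each axiom, and the two monotonicity conditions
defining the target space say exactly that `ξ(u, v)` dominates all the competitors.

For the second half, let `ρ` be the weight of words and `N(t)` the number of words in the cut set
at level `t`. Extending words letter by letter shows that `N` is supermultiplicative up to a bounded
shift (`IsWordWeight.ncard_mul_ncard_le`), so Fekete's lemma gives the critical exponent `h`. As a
ball of radius `2 ^ (-t)` meets subexponentially many cylinders of level `t`, `N(t)` is at most the
covering number of `X` at scale `2 ^ (-t)` up to a subexponential factor, whence `h ≤ α`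
(`exists_criticalExponent`).

The images `f_w(F)` of the condensation set have branching function `ψ(u - ρ(w), v - ρ(w))` up to
`o(u)`. For `ρ(w) = z ≤ v` such an image accounts for the value `ψ(u - z, v - z)`; for `z ≥ v` a ball
of radius `2 ^ (-v)` contains `2 ^ (h (z - v))` images with `ρ(w) ≈ z` up to a subexponential factor,
each needing `2 ^ ψ(u - z, 0)` balls of radius `2 ^ (-u)`, and by asymptotic boundedness no ball is
used by many images. This gives the lower bound (`IsBranchingModel.le_br_of_le`,
`IsBranchingModel.le_br_of_ge`). Conversely, up to cylinders of level `u` the attractor is the union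
of the images with `ρ(w) < u`. Sorted by weight into `O(u)` classes, those meeting a given ball are
counted by `ncard_near_le`, and each class costs at most `Φ_h(ψ)(u, v) + o(u)`
(`IsBranchingModel.br_le`). The contractions may distort by subexponential factors; these are
harmless since, `X` having finite quasi-Assouad dimension, a set of diameter `2 ^ (-m + o(m))` is
covered by `2 ^ o(m)` balls of radius `2 ^ (-m)` (`HasQuasiAssouadDim.exists_error_coverable`).
-/

namespace TwoScaleBranching

/-! ### The maximum defining `Φ_h` -/

section

variable {α h : ℝ} {ψ : Delta → ℝ}

lemma IsB.continuous (hψ : IsB α ψ) : Continuous ψ := by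
  rw [Metric.continuous_iff]
  intro q ε hε
  refine ⟨ε / (2 * (|α| + 1)), by positivity, fun p hp => ?_⟩
  rw [Subtype.dist_eq, Prod.dist_eq, max_lt_iff, Real.dist_eq, Real.dist_eq] at hp
  rw [Real.dist_eq]
  refine (hψ.lipschitz p q).trans_lt ?_
  have h1 : |p.1.1 - q.1.1| + |p.1.2 - q.1.2| < ε / (|α| + 1) := by
    have : ε / (2 * (|α| + 1)) + ε / (2 * (|α| + 1)) = ε / (|α| + 1) := by field_simp; norm_num
    linarith [hp.1, hp.2]
  rw [lt_div_iff₀ (by positivity)] at h1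
  have h2 : α ≤ |α| := le_abs_self α
  nlinarith [abs_nonneg (p.1.1 - q.1.1), abs_nonneg (p.1.2 - q.1.2)]

lemma IsB.isGreatest_Phi (hψ : IsB α ψ) (h : ℝ) (p : Delta) :
    IsGreatest (PhiValues h ψ p) (Phi h ψ p) := by
  obtain ⟨⟨u, v⟩, hv, hvu⟩ := p
  dsimp only at hv hvu
  have hc := hψ.continuous
  have e1 : {t | ∃ (z : ℝ) (_ : 0 ≤ z) (hzv : z ≤ v),
      t = ψ ⟨(u - z, v - z), sub_nonneg.2 hzv, sub_le_sub_right hvu z⟩} =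
      range fun z : Icc 0 v =>
        ψ ⟨(u - z, v - z), sub_nonneg.2 z.2.2, sub_le_sub_right hvu z.1⟩ := by
    ext t
    constructor
    · rintro ⟨z, h0, hz, rfl⟩
      exact ⟨⟨z, h0, hz⟩, rfl⟩
    · rintro ⟨z, rfl⟩
      exact ⟨z, z.2.1, z.2.2, rfl⟩
  have e2 : {t | ∃ (z : ℝ) (_ : v ≤ z) (hzu : z ≤ u),
      t = h * (z - v) + ψ ⟨(u - z, 0), le_refl 0, sub_nonneg.2 hzu⟩} =
      range fun z : Icc v u =>
        h * (z - v) + ψ ⟨(u - z, 0), le_refl 0, sub_nonneg.2 z.2.2⟩ := by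
    ext t
    constructor
    · rintro ⟨z, h0, hz, rfl⟩
      exact ⟨⟨z, h0, hz⟩, rfl⟩
    · rintro ⟨z, rfl⟩
      exact ⟨z, z.2.1, z.2.2, rfl⟩
  have hK : IsCompact (PhiValues h ψ ⟨(u, v), hv, hvu⟩) := by
    unfold PhiValues
    dsimp only
    rw [e1, e2]
    refine (isCompact_range ?_).union (isCompact_range ?_)
    · exact hc.comp (Continuous.subtype_mk (by fun_prop) _)
    · exact Continuous.add (by fun_prop) (hc.comp (Continuous.subtype_mk (by fun_prop) _))
  refine hK.isGreatest_sSup ⟨_, Or.inl ⟨0, le_rfl, hv, rfl⟩⟩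

lemma IsB.le_Phi_of_le (hψ : IsB α ψ) (h : ℝ) {u v z : ℝ} (hz : 0 ≤ z) (hzv : z ≤ v) (hvu : v ≤ u) :
    ψ ⟨(u - z, v - z), sub_nonneg.2 hzv, sub_le_sub_right hvu z⟩ ≤
      Phi h ψ ⟨(u, v), hz.trans hzv, hvu⟩ :=
  (hψ.isGreatest_Phi h ⟨(u, v), hz.trans hzv, hvu⟩).2 (Or.inl ⟨z, hz, hzv, rfl⟩)

lemma IsB.le_Phi_of_ge (hψ : IsB α ψ) (h : ℝ) {u v z : ℝ} (hv : 0 ≤ v) (hvz : v ≤ z)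
    (hzu : z ≤ u) :
    h * (z - v) + ψ ⟨(u - z, 0), le_refl 0, sub_nonneg.2 hzu⟩ ≤
      Phi h ψ ⟨(u, v), hv, hvz.trans hzu⟩ :=
  (hψ.isGreatest_Phi h ⟨(u, v), hv, hvz.trans hzu⟩).2 (Or.inr ⟨z, hvz, hzu, rfl⟩)

lemma IsB.Phi_le (hψ : IsB α ψ) (h : ℝ) {u v c : ℝ} (hv : 0 ≤ v) (hvu : v ≤ u)
    (h1 : ∀ z (_ : 0 ≤ z) (hzv : z ≤ v),
      ψ ⟨(u - z, v - z), sub_nonneg.2 hzv, sub_le_sub_right hvu z⟩ ≤ c)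
    (h2 : ∀ z (_ : v ≤ z) (hzu : z ≤ u),
      h * (z - v) + ψ ⟨(u - z, 0), le_refl 0, sub_nonneg.2 hzu⟩ ≤ c) :
    Phi h ψ ⟨(u, v), hv, hvu⟩ ≤ c := by
  rcases (hψ.isGreatest_Phi h ⟨(u, v), hv, hvu⟩).1 with ⟨z, hz, hzv, e⟩ | ⟨z, hz, hzu, e⟩
  · rw [e]; exact h1 z hz hzv
  · rw [e]; exact h2 z hz hzu

lemma IsB.lipschitz_of_le (hψ : IsB α ψ) {u v u' v' d : ℝ} (hv : 0 ≤ v) (hvu : v ≤ u)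
    (hv' : 0 ≤ v') (hvu' : v' ≤ u') (hα : 0 ≤ α) (hd : |u - u'| + |v - v'| ≤ d) :
    ψ ⟨(u, v), hv, hvu⟩ ≤ ψ ⟨(u', v'), hv', hvu'⟩ + α * d := by
  have := (abs_le.1 (hψ.lipschitz ⟨(u, v), hv, hvu⟩ ⟨(u', v'), hv', hvu'⟩)).2
  have h2 := mul_le_mul_of_nonneg_left hd hα
  dsimp only at this
  linarith

lemma IsB.Phi_diag (hψ : IsB α ψ) (h : ℝ) {u : ℝ} (hu : 0 ≤ u) :
    Phi h ψ ⟨(u, u), hu, le_rfl⟩ = 0 := by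
  apply le_antisymm
  · refine hψ.Phi_le h (by linarith) (by linarith) ?_ ?_
    · intro z hz hzu
      exact (hψ.diag _ (sub_nonneg.2 hzu)).le
    · intro z hz hzu
      obtain rfl : z = u := le_antisymm hzu hz
      have := hψ.diag 0 le_rfl
      simp [this]
  · have := hψ.le_Phi_of_le h le_rfl hu (le_refl u)
    exact (hψ.nonneg _).trans this

lemma IsB.Phi_subadd (hψ : IsB α ψ) (h : ℝ) {v w u : ℝ} (hv : 0 ≤ v) (hvw : v ≤ w)
    (hwu : w ≤ u) :
    Phi h ψ ⟨(u, v), hv, hvw.trans hwu⟩ ≤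
      Phi h ψ ⟨(u, w), hv.trans hvw, hwu⟩ + Phi h ψ ⟨(w, v), hv, hvw⟩ := by
  refine hψ.Phi_le h (by linarith) (by linarith) ?_ ?_
  · intro z hz hzv
    have h1 := hψ.le_Phi_of_le h hz (hzv.trans hvw) hwu
    have h2 := hψ.le_Phi_of_le h hz hzv hvw
    have := hψ.subadd (v - z) (w - z) (u - z) (by linarith) (by linarith) (by linarith)
    linarith
  · intro z hvz hzu
    rcases le_total z w with hzw | hwz
    · have h1 := hψ.le_Phi_of_le h (hv.trans hvz) hzw hwu
      have h2 := hψ.le_Phi_of_ge h hv hvz hzw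
      have := hψ.subadd 0 (w - z) (u - z) le_rfl (by linarith) (by linarith)
      linarith
    · have h1 := hψ.le_Phi_of_ge h (hv.trans hvw) hwz hzu
      have h2 := hψ.le_Phi_of_ge h hv hvw le_rfl
      have h3 := hψ.nonneg ⟨(w - w, 0), le_rfl, sub_nonneg.2 le_rfl⟩
      nlinarith

lemma IsB.Phi_mono_left (hψ : IsB α ψ) (h : ℝ) {v w u : ℝ} (hv : 0 ≤ v) (hvw : v ≤ w)
    (hwu : w ≤ u) :
    Phi h ψ ⟨(w, v), hv, hvw⟩ ≤ Phi h ψ ⟨(u, v), hv, hvw.trans hwu⟩ := by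
  refine hψ.Phi_le h (by linarith) (by linarith) ?_ ?_
  · intro z hz hzv
    exact (hψ.mono_left (v - z) (w - z) (u - z) (by linarith) (by linarith) (by linarith)).trans
      (hψ.le_Phi_of_le h hz hzv (hvw.trans hwu))
  · intro z hvz hzw
    have h1 := hψ.le_Phi_of_ge h hv hvz (hzw.trans hwu)
    have := hψ.mono_left 0 (w - z) (u - z) le_rfl (by linarith) (by linarith)
    linarith

lemma IsB.Phi_anti_right (hψ : IsB α ψ) (hh : 0 ≤ h) {v w u : ℝ} (hv : 0 ≤ v) (hvw : v ≤ w)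
    (hwu : w ≤ u) :
    Phi h ψ ⟨(u, w), hv.trans hvw, hwu⟩ ≤ Phi h ψ ⟨(u, v), hv, hvw.trans hwu⟩ := by
  refine hψ.Phi_le h (by linarith) (by linarith) ?_ ?_
  · intro z hz hzw
    rcases le_total z v with hzv | hvz
    · exact (hψ.anti_right (v - z) (w - z) (u - z) (by linarith) (by linarith)
        (by linarith)).trans (hψ.le_Phi_of_le h hz hzv (hvw.trans hwu))
    · have h1 := hψ.le_Phi_of_ge h hv hvz (hzw.trans hwu)
      have := hψ.anti_right 0 (w - z) (u - z) le_rfl (by linarith) (by linarith)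
      nlinarith
  · intro z hwz hzu
    have h1 := hψ.le_Phi_of_ge h hv (hvw.trans hwz) hzu
    nlinarith

lemma IsB.Phi_lipschitz_left (hψ : IsB α ψ) (hα : 0 ≤ α) (hh : h ≤ α) {v w u : ℝ}
    (hv : 0 ≤ v) (hvw : v ≤ w) (hwu : w ≤ u) :
    Phi h ψ ⟨(u, v), hv, hvw.trans hwu⟩ ≤ Phi h ψ ⟨(w, v), hv, hvw⟩ + α * (u - w) := by
  refine hψ.Phi_le h (by linarith) (by linarith) ?_ ?_
  · intro z hz hzv
    have h1 := hψ.le_Phi_of_le h hz hzv hvw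
    have := hψ.lipschitz_of_le (d := u - w) (u := u - z) (v := v - z) (u' := w - z) (v' := v - z)
      (by linarith) (by linarith) (by linarith) (by linarith) hα
      (by rw [abs_of_nonneg (by linarith)]; simp)
    linarith
  · intro z hvz hzu
    rcases le_total z w with hzw | hwz
    · have h1 := hψ.le_Phi_of_ge h hv hvz hzw
      have := hψ.lipschitz_of_le (d := u - w) (u := u - z) (v := 0) (u' := w - z) (v' := 0)
        (by linarith) (by linarith) (by linarith) (by linarith) hα
        (by rw [abs_of_nonneg (by linarith)]; simp)
      linarith
    · have h1 := hψ.le_Phi_of_ge h hv hvw le_rfl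
      have h3 := hψ.nonneg ⟨(w - w, 0), le_rfl, sub_nonneg.2 le_rfl⟩
      have := hψ.lipschitz_of_le (d := u - z) (u := u - z) (v := 0) (u' := 0) (v' := 0)
        (by linarith) (by linarith) (by linarith) (by linarith) hα
        (by rw [abs_of_nonneg (by linarith)]; simp)
      rw [hψ.diag 0 le_rfl] at this
      nlinarith

lemma IsB.Phi_lipschitz_right (hψ : IsB α ψ) (hα : 0 ≤ α) (hh : h ≤ α) {v w u : ℝ}
    (hv : 0 ≤ v) (hvw : v ≤ w) (hwu : w ≤ u) :
    Phi h ψ ⟨(u, v), hv, hvw.trans hwu⟩ ≤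
      Phi h ψ ⟨(u, w), hv.trans hvw, hwu⟩ + α * (w - v) := by
  refine hψ.Phi_le h (by linarith) (by linarith) ?_ ?_
  · intro z hz hzv
    have h1 := hψ.le_Phi_of_le h hz (hzv.trans hvw) hwu
    have := hψ.lipschitz_of_le (d := w - v) (u := u - z) (v := v - z) (u' := u - z) (v' := w - z)
      (by linarith) (by linarith) (by linarith) (by linarith) hα
      (by rw [sub_self, abs_zero, abs_of_nonpos (by linarith)]; linarith)
    linarith
  · intro z hvz hzu
    rcases le_total z w with hzw | hwz
    · have h1 := hψ.le_Phi_of_le h (hv.trans hvz) hzw hwu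
      have := hψ.lipschitz_of_le (d := w - z) (u := u - z) (v := 0) (u' := u - z) (v' := w - z)
        (by linarith) (by linarith) (by linarith) (by linarith) hα
        (by rw [sub_self, abs_zero, abs_of_nonpos (by linarith)]; linarith)
      nlinarith
    · have h1 := hψ.le_Phi_of_ge h (hv.trans hvw) hwz hzu
      nlinarith

lemma IsB.Phi_le_add (hψ : IsB α ψ) (hh : 0 ≤ h) (hhα : h ≤ α) (p q : Delta) :
    Phi h ψ p ≤ Phi h ψ q + α * (|p.1.1 - q.1.1| + |p.1.2 - q.1.2|) := by
  obtain ⟨⟨u, v⟩, hv, hvu⟩ := p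
  obtain ⟨⟨u', v'⟩, hv', hvu'⟩ := q
  dsimp only at hv hvu hv' hvu' ⊢
  have hα := hh.trans hhα
  have h0 : 0 ≤ min v v' := le_min hv hv'
  have h1 := hψ.Phi_mono_left h hv hvu (le_max_left u u')
  have h2 := hψ.Phi_anti_right hh h0 (min_le_left v v') (hvu.trans (le_max_left u u'))
  have h3 := hψ.Phi_lipschitz_left hα hhα h0 ((min_le_right v v').trans hvu') (le_max_right u u')
  have h4 := hψ.Phi_lipschitz_right hα hhα h0 (min_le_right v v') hvu'
  have e1 : max u u' - u' ≤ |u - u'| := by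
    rcases le_total u u' with h | h
    · simp [h]
    · rw [max_eq_left h]; exact le_abs_self _
  have e2 : v' - min v v' ≤ |v - v'| := by
    rcases le_total v v' with h | h
    · rw [min_eq_left h, abs_sub_comm]; exact le_abs_self _
    · simp [h]
  nlinarith [mul_le_mul_of_nonneg_left e1 hα, mul_le_mul_of_nonneg_left e2 hα]

theorem IsB.isB_Phi (hψ : IsB α ψ) (hh : 0 ≤ h) (hhα : h ≤ α) : IsB α (Phi h ψ) where
  nonneg p := (hψ.nonneg _).trans (hψ.le_Phi_of_le h le_rfl p.2.1 p.2.2)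
  diag u hu := hψ.Phi_diag h hu
  subadd v w u hv hvw hwu := hψ.Phi_subadd h hv hvw hwu
  mono_left v w u hv hvw hwu := hψ.Phi_mono_left h hv hvw hwu
  anti_right v w u hv hvw hwu := hψ.Phi_anti_right hh hv hvw hwu
  lipschitz p q := by
    rw [abs_le]
    have h1 := hψ.Phi_le_add hh hhα p q
    have h2 := hψ.Phi_le_add hh hhα q p
    rw [abs_sub_comm q.1.1, abs_sub_comm q.1.2] at h2
    constructor <;> linarith

theorem IsB.Phi_mem_Bbar (hψ : IsB α ψ) (hh : 0 ≤ h) (hhα : h ≤ α) :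
    Phi h ψ ∈ Bbar h α := by
  refine ⟨hψ.isB_Phi hh hhα, fun u v z hv hvu hz => ?_, fun u v hv hvu => ?_⟩
  · refine hψ.Phi_le h (by linarith) (by linarith) ?_ ?_
    · intro s hs hsv
      have := hψ.le_Phi_of_le h (u := u + z) (v := v + z) (z := s + z)
        (by linarith) (by linarith) (by linarith)
      simpa only [add_sub_add_right_eq_sub] using this
    · intro s hs hsu
      have := hψ.le_Phi_of_ge h (u := u + z) (v := v + z) (z := s + z)
        (by linarith) (by linarith) (by linarith)
      simpa only [add_sub_add_right_eq_sub] using this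
  · rw [le_sub_comm]
    -- a shift `s` for `(v, 0)` corresponds to the shift `s + (u - v)` for `(u, 0)`
    have key : ∀ s (_ : 0 ≤ s) (hsv : s ≤ v),
        h * s + ψ ⟨(v - s, 0), le_rfl, sub_nonneg.2 hsv⟩ ≤
          Phi h ψ ⟨(u, 0), le_refl 0, hv.trans hvu⟩ - h * (u - v) := by
      intro s hs hsv
      have := hψ.le_Phi_of_ge h (u := u) (v := 0) (z := s + (u - v))
        le_rfl (by linarith) (by linarith)
      simp only [show u - (s + (u - v)) = v - s by ring] at this
      nlinarith
    refine hψ.Phi_le h (by linarith) (by linarith) ?_ ?_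
    · intro s hs hsv
      obtain rfl : s = 0 := le_antisymm hsv hs
      simpa using key 0 le_rfl hv
    · intro s hs hsv
      simpa using key s hs hsv

lemma IsB.le_Phi (hψ : IsB α ψ) (h : ℝ) : ψ ≤ Phi h ψ := fun p => by
  have := hψ.le_Phi_of_le h le_rfl p.2.1 p.2.2
  simpa using this

theorem IsB.Phi_le_of_mem_Bbar (hψ : IsB α ψ) {ξ : Delta → ℝ} (hξ : ξ ∈ Bbar h α)
    (hle : ψ ≤ ξ) : Phi h ψ ≤ ξ := by
  rintro ⟨⟨u, v⟩, hv, hvu⟩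
  dsimp only at hv hvu
  obtain ⟨hξB, hshift, hgrow⟩ := hξ
  refine hψ.Phi_le h (by linarith) (by linarith) ?_ ?_
  · intro z hz hzv
    refine (hle _).trans ?_
    simpa using hshift (u - z) (v - z) z (sub_nonneg.2 hzv) (sub_le_sub_right hvu z) hz
  · intro z hvz hzu
    have h1 := hle ⟨(u - z, 0), le_refl 0, sub_nonneg.2 hzu⟩
    have h2 := hgrow (u - v) (u - z) (by linarith) (by linarith)
    have h3 := hshift (u - v) 0 v le_rfl (by linarith) hv
    simp only [sub_add_cancel, zero_add] at h3
    nlinarith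

theorem Phi_eq_self_of_mem_Bbar {ξ : Delta → ℝ} (hξ : ξ ∈ Bbar h α) : Phi h ξ = ξ :=
  le_antisymm (IsB.Phi_le_of_mem_Bbar hξ.1 hξ le_rfl) (IsB.le_Phi hξ.1 h)

end

section

/-! ### Error functions -/

lemma IsErrorFunction.exists_le_linear {η : ℝ → ℝ} (hη : IsErrorFunction η) {ε : ℝ} (hε : 0 < ε) :
    ∃ K, 0 ≤ K ∧ ∀ u, 0 ≤ u → η u ≤ ε * u + K := by
  have h1 : ∀ᶠ u in atTop, η u / u < ε := hη.tendsto.eventually_lt_const hε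
  obtain ⟨U, hU⟩ := (h1.and (eventually_gt_atTop 0)).exists_forall_of_atTop
  have hU0 := (hU U le_rfl).2
  refine ⟨η U, hη.nonneg U hU0.le, fun u hu => ?_⟩
  rcases le_total U u with h | h
  · have := (hU u h)
    have h2 := (div_lt_iff₀ this.2).1 this.1
    have := hη.nonneg U hU0.le
    linarith
  · have := hη.mono hu hU0.le h
    nlinarith

lemma IsErrorFunction.of_le_linear {η : ℝ → ℝ} (h0 : ∀ u, 0 ≤ u → 0 ≤ η u)
    (hm : MonotoneOn η (Ici 0)) (hl : ∀ ε > 0, ∃ K, ∀ u, 0 ≤ u → η u ≤ ε * u + K) :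
    IsErrorFunction η where
  nonneg := h0
  mono := hm
  tendsto := by
    rw [Metric.tendsto_atTop]
    intro ε hε
    obtain ⟨K, hK⟩ := hl (ε / 2) (by positivity)
    refine ⟨max 1 (2 * K / ε + 1), fun u hu => ?_⟩
    have hu1 : 1 ≤ u := (le_max_left _ _).trans hu
    have hu2 : 2 * K / ε + 1 ≤ u := (le_max_right _ _).trans hu
    have hu3 : 2 * K / ε < u := by linarith
    rw [div_lt_iff₀ hε] at hu3
    have := hK u (by linarith)
    rw [Real.dist_eq, sub_zero, abs_of_nonneg (div_nonneg (h0 u (by linarith)) (by linarith)),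
      div_lt_iff₀ (by linarith)]
    nlinarith

/-- Bounds `ε m i + K_ε` for every `ε > 0` amount to a single sublinear bound in `m`. This is
how all error terms of the argument are turned into error functions. -/
theorem exists_isErrorFunction {ι : Type*} (P : ι → ℝ → Prop) (m : ι → ℝ) (hm : ∀ i, 0 ≤ m i)
    (hP : ∀ i b b', b ≤ b' → P i b → P i b')
    (H : ∀ ε > 0, ∃ K, ∀ i, P i (ε * m i + K)) :
    ∃ e, IsErrorFunction e ∧ ∀ i, P i (e (m i)) := by
  let G : ι → ℝ := fun i => sInf {b | 0 ≤ b ∧ P i b}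
  have hG : ∀ i b, 0 ≤ b → P i b → G i ≤ b := fun i b h0 hb => csInf_le ⟨0, fun _ h => h.1⟩ ⟨h0, hb⟩
  have hub : ∀ ε > 0, ∃ K, 0 ≤ K ∧ ∀ u, 0 ≤ u →
      ∀ t ∈ insert (0 : ℝ) (G '' {i | m i ≤ u}), t ≤ ε * u + K := by
    intro ε hε
    obtain ⟨K, hK⟩ := H ε hε
    refine ⟨max K 0, le_max_right _ _, ?_⟩
    rintro u hu t (rfl | ⟨i, hi, rfl⟩)
    · positivity
    · have h2 : m i ≤ u := hi
      have h3 : ε * m i + K ≤ ε * u + max K 0 :=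
        add_le_add (mul_le_mul_of_nonneg_left h2 hε.le) (le_max_left _ _)
      exact hG i _ (by positivity) (hP i _ _ h3 (hK i))
  have hbdd : ∀ u, 0 ≤ u → BddAbove (insert (0 : ℝ) (G '' {i | m i ≤ u})) := by
    intro u hu
    obtain ⟨K, -, hK⟩ := hub 1 one_pos
    exact ⟨_, hK u hu⟩
  refine ⟨fun u => sSup (insert (0 : ℝ) (G '' {i | m i ≤ u})) + 1,
    IsErrorFunction.of_le_linear ?_ ?_ ?_, ?_⟩
  · exact fun u hu => add_nonneg (le_csSup (hbdd u hu) (mem_insert _ _)) zero_le_one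
  · intro u hu u' hu' huu'
    refine add_le_add_left (csSup_le_csSup (hbdd u' hu') (insert_nonempty _ _)
      (insert_subset_insert ?_)) 1
    exact image_mono fun i hi => le_trans hi huu'
  · intro ε hε
    obtain ⟨K, -, hK⟩ := hub ε hε
    exact ⟨K + 1, fun u hu => by linarith [csSup_le (insert_nonempty _ _) (hK u hu)]⟩
  · intro i
    have h1 : G i ≤ sSup (insert (0 : ℝ) (G '' {j | m j ≤ m i})) :=
      le_csSup (hbdd _ (hm i)) (mem_insert_of_mem _ ⟨i, le_refl (m i), rfl⟩)
    obtain ⟨K, hK⟩ := H 1 one_pos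
    obtain ⟨b, ⟨-, hb⟩, hlt⟩ := exists_lt_of_csInf_lt (s := {b | 0 ≤ b ∧ P i b})
      ⟨max (1 * m i + K) 0, le_max_right _ _, hP i _ _ (le_max_left _ _) (hK i)⟩
      (lt_add_one (G i))
    exact hP i _ _ (by linarith) hb

lemma IsErrorFunction.add {η η' : ℝ → ℝ} (h : IsErrorFunction η) (h' : IsErrorFunction η') :
    IsErrorFunction fun u => η u + η' u where
  nonneg u hu := add_nonneg (h.nonneg u hu) (h'.nonneg u hu)
  mono := h.mono.add h'.mono
  tendsto := by simpa [add_div] using h.tendsto.add h'.tendsto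

lemma IsErrorFunction.const {c : ℝ} (hc : 0 ≤ c) : IsErrorFunction fun _ => c where
  nonneg _ _ := hc
  mono := monotoneOn_const
  tendsto := tendsto_const_nhds.div_atTop tendsto_id

lemma IsErrorFunction.const_mul {c : ℝ} (hc : 0 ≤ c) {η : ℝ → ℝ} (h : IsErrorFunction η) :
    IsErrorFunction fun u => c * η u where
  nonneg u hu := mul_nonneg hc (h.nonneg u hu)
  mono := fun _ ha _ hb hab => mul_le_mul_of_nonneg_left (h.mono ha hb hab) hc
  tendsto := by simpa [mul_div_assoc] using h.tendsto.const_mul c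

lemma IsErrorFunction.comp_add {c : ℝ} (hc : 0 ≤ c) {η : ℝ → ℝ} (h : IsErrorFunction η) :
    IsErrorFunction fun u => η (u + c) := by
  refine .of_le_linear (fun u hu => h.nonneg _ (by linarith)) ?_ fun ε hε => ?_
  · intro a ha b hb hab
    rw [mem_Ici] at ha hb
    exact h.mono (by rw [mem_Ici]; linarith) (by rw [mem_Ici]; linarith) (by linarith)
  · obtain ⟨K, -, hK⟩ := h.exists_le_linear hε
    exact ⟨ε * c + K, fun u hu => (hK (u + c) (by linarith)).trans (by linarith)⟩

/-! ### Covers -/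

/-- `S` is covered by at most `b` open balls of radius `r` with centres in `A`. -/
def Coverable {X : Type*} [MetricSpace X] (A S : Set X) (r b : ℝ) : Prop :=
  ∃ t : Finset X, ↑t ⊆ A ∧ S ⊆ ⋃ y ∈ t, Metric.ball y r ∧ (t.card : ℝ) ≤ b

variable {X : Type*} [MetricSpace X]

lemma coverNum_le_iff {r b : ℝ} (hb : 0 ≤ b) (S : Set X) :
    (coverNum r S : ℝ≥0∞) ≤ ENNReal.ofReal b ↔ Coverable univ S r b := by
  constructor
  · intro h
    have hne : {n : ℕ∞ | ∃ t : Finset X, S ⊆ (⋃ x ∈ t, Metric.ball x r) ∧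
        n = (t.card : ℕ∞)}.Nonempty := by
      by_contra hemp
      rw [not_nonempty_iff_eq_empty] at hemp
      unfold coverNum at h
      rw [hemp, sInf_empty] at h
      simp at h
    obtain ⟨t, ht, hn⟩ := csInf_mem hne
    refine ⟨t, subset_univ _, ht, ?_⟩
    unfold coverNum at h
    rw [hn, ENat.toENNReal_coe, ← ENNReal.ofReal_natCast] at h
    exact (ENNReal.ofReal_le_ofReal_iff hb).1 h
  · rintro ⟨t, -, ht, hc⟩
    have h1 : coverNum r S ≤ t.card := sInf_le ⟨t, ht, rfl⟩
    have h2 : (coverNum r S : ℝ≥0∞) ≤ ((t.card : ℕ∞) : ℝ≥0∞) := by exact_mod_cast h1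
    refine h2.trans ?_
    rw [ENat.toENNReal_coe, ← ENNReal.ofReal_natCast]
    exact ENNReal.ofReal_le_ofReal hc

lemma branching_le_iff' (u v b : ℝ) :
    branching X u v ≤ (b : EReal) ↔
      ∀ x : X, Coverable univ (Metric.ball x ((2 : ℝ) ^ (-v))) ((2 : ℝ) ^ (-u)) ((2 : ℝ) ^ b) := by
  have hl : 0 < Real.log 2 := Real.log_pos one_lt_two
  simp_rw [← coverNum_le_iff (Real.rpow_nonneg zero_le_two b), ← iSup_le_iff]
  unfold branching
  rw [EReal.div_le_iff_le_mul (by exact_mod_cast hl) (EReal.coe_ne_top _), ← EReal.coe_mul,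
    ← EReal.exp_le_exp_iff, ENNReal.exp_log, EReal.exp_coe,
    Real.rpow_def_of_pos two_pos b]

lemma coverable_coe_iff (A : Set X) (x : A) (R r b : ℝ) :
    Coverable (univ : Set A) (Metric.ball x R) r b ↔
      Coverable A (A ∩ Metric.ball (x : X) R) r b := by
  classical
  constructor
  · rintro ⟨t, -, ht, hc⟩
    refine ⟨t.map (Function.Embedding.subtype _), by simp, ?_, by simpa using hc⟩
    rintro y ⟨hy, hyx⟩
    have := ht (show (⟨y, hy⟩ : A) ∈ Metric.ball x R from hyx)
    simp only [mem_iUnion] at this ⊢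
    obtain ⟨z, hz, hyz⟩ := this
    exact ⟨z, by simpa using hz, hyz⟩
  · rintro ⟨t, htA, ht, hc⟩
    refine ⟨t.subtype (· ∈ A), subset_univ _, ?_, ?_⟩
    · rintro y hy
      have := ht ⟨y.2, hy⟩
      simp only [mem_iUnion] at this ⊢
      obtain ⟨z, hz, hyz⟩ := this
      exact ⟨⟨z, htA hz⟩, by simpa using hz, hyz⟩
    · refine le_trans ?_ hc
      rw [Finset.card_subtype]
      exact_mod_cast Finset.card_filter_le _ _

lemma branching_le_iff (A : Set X) (u v b : ℝ) :
    branching A u v ≤ (b : EReal) ↔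
      ∀ x ∈ A, Coverable A (A ∩ Metric.ball x ((2 : ℝ) ^ (-v))) ((2 : ℝ) ^ (-u)) ((2 : ℝ) ^ b) := by
  rw [branching_le_iff', Subtype.forall]
  simp_rw [coverable_coe_iff]

lemma Coverable.mono {A A' S S' : Set X} {r r' b b' : ℝ} (h : Coverable A S r b) (hA : A ⊆ A')
    (hS : S' ⊆ S) (hr : r ≤ r') (hb : b ≤ b') : Coverable A' S' r' b' := by
  obtain ⟨t, htA, ht, hc⟩ := h
  refine ⟨t, htA.trans hA, (hS.trans ht).trans ?_, hc.trans hb⟩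
  exact iUnion₂_mono fun y _ => Metric.ball_subset_ball hr

lemma Coverable.one_le {A S : Set X} {r b : ℝ} (h : Coverable A S r b) (hS : S.Nonempty) :
    1 ≤ b := by
  obtain ⟨t, -, ht, hc⟩ := h
  obtain ⟨x, hx⟩ := hS
  have := ht hx
  simp only [mem_iUnion] at this
  obtain ⟨y, hy, -⟩ := this
  have : 1 ≤ t.card := Finset.card_pos.2 ⟨y, hy⟩
  exact le_trans (by exact_mod_cast this) hc

/-- A cover of `S` by balls with arbitrary centres becomes a cover with centres in `S` when the
radius is doubled, and only the balls which meet `S` count. -/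
lemma coverable_recenter {S : Set X} {r : ℝ} (t : Finset X)
    (ht : S ⊆ ⋃ y ∈ t, Metric.ball y r) (J : Finset X)
    (hJ : ∀ y ∈ t, (S ∩ Metric.ball y r).Nonempty → y ∈ J) :
    Coverable S S (2 * r) J.card := by
  classical
  let c : X → X := fun y => if h : (S ∩ Metric.ball y r).Nonempty then h.some else y
  refine ⟨(J.filter fun y => (S ∩ Metric.ball y r).Nonempty).image c, ?_, ?_, ?_⟩
  · intro z hz
    simp only [Finset.coe_image, Finset.coe_filter, mem_image, mem_ofPred_eq] at hz
    obtain ⟨y, ⟨-, hy⟩, rfl⟩ := hz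
    simp only [c, dif_pos hy]
    exact hy.some_mem.1
  · intro x hx
    have := ht hx
    simp only [mem_iUnion] at this ⊢
    obtain ⟨y, hy, hxy⟩ := this
    have hne : (S ∩ Metric.ball y r).Nonempty := ⟨x, hx, hxy⟩
    refine ⟨c y, Finset.mem_image_of_mem _ (Finset.mem_filter.2 ⟨hJ y hy hne, hne⟩), ?_⟩
    simp only [c, dif_pos hne, Metric.mem_ball]
    have h1 : dist hne.some y < r := hne.some_mem.2
    have h2 : dist x y < r := hxy
    linarith [dist_triangle_right x hne.some y]
  · exact_mod_cast Finset.card_image_le.trans (Finset.card_filter_le _ _)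

lemma Coverable.recenter {A S : Set X} {r b : ℝ} (h : Coverable A S r b) :
    Coverable S S (2 * r) b := by
  obtain ⟨t, -, ht, hc⟩ := h
  exact (coverable_recenter t ht t fun y hy _ => hy).mono le_rfl le_rfl le_rfl hc

lemma Coverable.union {A S S' : Set X} {r b b' : ℝ} (h : Coverable A S r b)
    (h' : Coverable A S' r b') : Coverable A (S ∪ S') r (b + b') := by
  classical
  obtain ⟨t, htA, ht, hc⟩ := h
  obtain ⟨t', htA', ht', hc'⟩ := h'
  refine ⟨t ∪ t', by simp [htA, htA'], ?_, ?_⟩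
  · refine union_subset (ht.trans ?_) (ht'.trans ?_) <;>
      exact biUnion_subset_biUnion_left (by simp)
  · have : ((t ∪ t').card : ℝ) ≤ t.card + t'.card := by exact_mod_cast Finset.card_union_le _ _
    linarith

lemma Coverable.biUnion {ι : Type*} {A : Set X} {S : ι → Set X} {r b : ℝ} (T : Finset ι)
    (h : ∀ i ∈ T, Coverable A (S i) r b) : Coverable A (⋃ i ∈ T, S i) r (T.card * b) := by
  classical
  induction T using Finset.induction_on with
  | empty => exact ⟨∅, by simp, by simp, by simp⟩
  | insert i T hi ih =>
    rw [Finset.card_insert_of_notMem hi, Finset.set_biUnion_insert]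
    push_cast
    rw [add_mul, one_mul, add_comm]
    exact (h i (by simp)).union (ih fun j hj => h j (by simp [hj]))

lemma coverable_biUnion_of_ncard_le {ι : Type*} {A : Set X} {W : Set ι} (hW : W.Finite)
    {S : ι → Set X} {r a b : ℝ} (hcard : (W.ncard : ℝ) ≤ (2 : ℝ) ^ a)
    (h : ∀ w ∈ W, Coverable A (S w) r ((2 : ℝ) ^ b)) :
    Coverable A (⋃ w ∈ W, S w) r ((2 : ℝ) ^ (a + b)) := by
  have h1 := Coverable.biUnion hW.toFinset fun w hw => h w (by simpa using hw)
  refine h1.mono le_rfl (by simp) le_rfl ?_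
  rw [Real.rpow_add two_pos, ← ncard_eq_toFinset_card W hW]
  gcongr

lemma Coverable.trans {A S : Set X} {R r b b' : ℝ} (h : Coverable A S R b) (hb' : 0 ≤ b')
    (hSA : S ⊆ A) (h' : ∀ x ∈ A, Coverable A (A ∩ Metric.ball x R) r b') :
    Coverable A S r (b * b') := by
  obtain ⟨t, htA, ht, hc⟩ := h
  refine (Coverable.biUnion (S := fun x => A ∩ Metric.ball x R) t
    fun x hx => h' x (htA hx)).mono le_rfl ?_ le_rfl (mul_le_mul_of_nonneg_right hc hb')
  intro x hx
  have := ht hx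
  simp only [mem_iUnion] at this ⊢
  obtain ⟨y, hy, hxy⟩ := this
  exact ⟨y, hy, hSA hx, hxy⟩

lemma exists_coverable_of_isCompact {A : Set X} (hA : IsCompact A) {r : ℝ} (hr : 0 < r) :
    ∃ b : ℝ, 0 ≤ b ∧ Coverable A A r ((2 : ℝ) ^ b) := by
  obtain ⟨t, htA, htf, ht⟩ := hA.finite_cover_balls hr
  refine ⟨htf.toFinset.card, by positivity, htf.toFinset, by simpa using htA, by simpa using ht, ?_⟩
  rw [Real.rpow_natCast]
  exact_mod_cast Nat.lt_two_pow_self.le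

/-- The two-scale branching function of a subset of `X` as a real number. It is meaningful for
non-empty compact sets, whose branching function is finite. -/
noncomputable def br (A : Set X) (u v : ℝ) : ℝ := (branching A u v).toReal

lemma branching_nonneg {A : Set X} (hne : A.Nonempty) (u v : ℝ) : 0 ≤ branching A u v := by
  by_contra hlt
  obtain ⟨b, hb1, hb2⟩ := EReal.lt_iff_exists_real_btwn.1 (not_le.1 hlt)
  obtain ⟨x, hx⟩ := hne
  have h1 := ((branching_le_iff A u v b).1 hb1.le x hx).one_le
    ⟨x, hx, Metric.mem_ball_self (by positivity)⟩
  have hb : b < 0 := by exact_mod_cast hb2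
  exact absurd h1 (not_le.2 (Real.rpow_lt_one_of_one_lt_of_neg one_lt_two hb))

lemma coe_br {A : Set X} (hA : IsCompact A) (hne : A.Nonempty) (u v : ℝ) :
    (br A u v : EReal) = branching A u v := by
  obtain ⟨b, hb0, hb⟩ := exists_coverable_of_isCompact hA (r := (2 : ℝ) ^ (-u)) (by positivity)
  refine EReal.coe_toReal (ne_top_of_le_ne_top (EReal.coe_ne_top b) ?_)
    (ne_bot_of_le_ne_bot EReal.zero_ne_bot (branching_nonneg hne u v))
  exact (branching_le_iff A u v b).2
    fun x _ => hb.mono le_rfl inter_subset_left le_rfl le_rfl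

lemma br_nonneg {A : Set X} (hne : A.Nonempty) (u v : ℝ) : 0 ≤ br A u v :=
  EReal.toReal_nonneg (branching_nonneg hne u v)

lemma br_le_iff {A : Set X} (hA : IsCompact A) (hne : A.Nonempty) {u v b : ℝ} :
    br A u v ≤ b ↔
      ∀ x ∈ A, Coverable A (A ∩ Metric.ball x ((2 : ℝ) ^ (-v))) ((2 : ℝ) ^ (-u)) ((2 : ℝ) ^ b) := by
  rw [← branching_le_iff, ← coe_br hA hne, EReal.coe_le_coe_iff]

lemma coverable_br {A : Set X} (hA : IsCompact A) (hne : A.Nonempty) (u v : ℝ) :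
    ∀ x ∈ A, Coverable A (A ∩ Metric.ball x ((2 : ℝ) ^ (-v))) ((2 : ℝ) ^ (-u))
      ((2 : ℝ) ^ br A u v) :=
  (br_le_iff hA hne).1 le_rfl

lemma within_coe_iff {a b e : ℝ} : Within (a : EReal) (b : EReal) e ↔ a ≤ b + e ∧ b ≤ a + e := by
  unfold Within
  rw [← EReal.coe_add, ← EReal.coe_add, EReal.coe_le_coe_iff, EReal.coe_le_coe_iff]

lemma two_mul_rpow_neg (u : ℝ) : 2 * (2 : ℝ) ^ (-u) = (2 : ℝ) ^ (-(u - 1)) := by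
  rw [neg_sub, sub_eq_add_neg, Real.rpow_add two_pos, Real.rpow_one]

end

/-! ### Almost additive weights on finite words -/

/-- An almost additive weight on words with defect at most `A`, whose increments under appending a
letter lie between `δ` and `C`. -/
structure IsWordWeight {I : Type*} (ρ : List I → ℝ) (A δ C : ℝ) : Prop where
  nil : ρ [] = 0
  defect_nonneg : 0 ≤ A
  step_pos : 0 < δ
  le_letter : ∀ i, δ ≤ ρ [i]
  letter_le : ∀ i, ρ [i] + A ≤ C
  superadd : ∀ w w', ρ w + ρ w' ≤ ρ (w ++ w')
  subadd : ∀ w w', ρ (w ++ w') ≤ ρ w + ρ w' + A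

lemma IsMinimallyDistorting.exists_isWordWeight {X I : Type*} [MetricSpace X] [Finite I]
    [Nonempty I] {f : I → X → X} {F : Set X} {ρ : List I → ℝ}
    (hρ : IsMinimallyDistorting f F ρ) : ∃ A δ C, IsWordWeight ρ A δ C := by
  obtain ⟨A, hA0, hA⟩ := hρ.almost_additive
  obtain ⟨i, hi⟩ := Finite.exists_min fun i => ρ [i]
  obtain ⟨j, hj⟩ := Finite.exists_max fun i => ρ [i]
  exact ⟨A, ρ [i], ρ [j] + A, hρ.nil, hA0, hρ.pos _ (by simp), hi,
    fun k => by linarith [hj k], fun w w' => by linarith [(hA w w').1],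
    fun w w' => by linarith [(hA w w').2]⟩

lemma ne_nil_of_mem_cutSet {I : Type*} {ρ : List I → ℝ} {u : ℝ} {w : List I}
    (hw : w ∈ cutSet ρ u) : w ≠ [] := by
  rintro rfl
  exact absurd hw.1 (not_lt.2 hw.2)

namespace IsWordWeight

variable {I : Type*} {ρ : List I → ℝ} {A δ C : ℝ}

lemma add_step_le (hρ : IsWordWeight ρ A δ C) (w : List I) (i : I) :
    ρ w + δ ≤ ρ (w ++ [i]) := by
  linarith [hρ.superadd w [i], hρ.le_letter i]

lemma le_add_step (hρ : IsWordWeight ρ A δ C) (w : List I) (i : I) :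
    ρ (w ++ [i]) ≤ ρ w + C := by
  linarith [hρ.subadd w [i], hρ.letter_le i]

lemma length_le (hρ : IsWordWeight ρ A δ C) (w : List I) : δ * w.length ≤ ρ w := by
  induction w using List.reverseRecOn with
  | nil => simp [hρ.nil]
  | append_singleton w i ih =>
    have := hρ.add_step_le w i
    simp only [List.length_append, List.length_singleton]
    push_cast
    linarith

lemma nonneg (hρ : IsWordWeight ρ A δ C) (w : List I) : 0 ≤ ρ w :=
  (mul_nonneg hρ.step_pos.le (Nat.cast_nonneg _)).trans (hρ.length_le w)

lemma mono (hρ : IsWordWeight ρ A δ C) {w w' : List I} (h : w <+: w') : ρ w ≤ ρ w' := by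
  obtain ⟨s, rfl⟩ := h
  linarith [hρ.superadd w s, hρ.nonneg s]

lemma cutSet_eq_empty (hρ : IsWordWeight ρ A δ C) {u : ℝ} (hu : u ≤ 0) : cutSet ρ u = ∅ := by
  ext w
  simp only [mem_empty_iff_false, iff_false]
  intro hw
  linarith [hw.1, hρ.nonneg w.dropLast]

lemma step_le (hρ : IsWordWeight ρ A δ C) [Nonempty I] : δ + A ≤ C := by
  obtain ⟨i⟩ := ‹Nonempty I›
  linarith [hρ.le_letter i, hρ.letter_le i]

lemma le_dropLast_add (hρ : IsWordWeight ρ A δ C) {w : List I} (hw : w ≠ []) :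
    ρ w ≤ ρ w.dropLast + C := by
  have := hρ.le_add_step w.dropLast (w.getLast hw)
  rwa [List.dropLast_append_getLast] at this

lemma dropLast_add_le (hρ : IsWordWeight ρ A δ C) {w : List I} (hw : w ≠ []) :
    ρ w.dropLast + δ ≤ ρ w := by
  have := hρ.add_step_le w.dropLast (w.getLast hw)
  rwa [List.dropLast_append_getLast] at this

lemma lt_add_of_mem_cutSet (hρ : IsWordWeight ρ A δ C) {u : ℝ} {w : List I}
    (hw : w ∈ cutSet ρ u) : ρ w < u + C := by
  linarith [hρ.le_dropLast_add (ne_nil_of_mem_cutSet hw), hw.1]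

lemma finite_cutSet (hρ : IsWordWeight ρ A δ C) [Finite I] (u : ℝ) : (cutSet ρ u).Finite := by
  refine (List.finite_length_le I (⌈u / δ⌉₊ + 1)).subset fun w hw => ?_
  have h1 := (hρ.length_le w.dropLast).trans hw.1.le
  have h2 : ((w.length - 1 : ℕ) : ℝ) ≤ ⌈u / δ⌉₊ := by
    rw [← List.length_dropLast]
    refine le_trans ?_ (Nat.le_ceil _)
    rw [le_div_iff₀ hρ.step_pos]
    linarith
  have h3 : w.length - 1 ≤ ⌈u / δ⌉₊ := by exact_mod_cast h2
  simp only [mem_ofPred_eq]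
  omega

lemma eq_of_prefix (hρ : IsWordWeight ρ A δ C) {u : ℝ} {w w' : List I}
    (hw : w ∈ cutSet ρ u) (hw' : w' ∈ cutSet ρ u) (h : w <+: w') : w = w' := by
  by_contra hne
  have h1 : w <+: w'.dropLast := by
    rw [← List.dropLast_append_getLast (ne_nil_of_mem_cutSet hw'), List.prefix_concat_iff,
      List.dropLast_append_getLast] at h
    exact h.resolve_left hne
  exact absurd ((hw.2.trans (hρ.mono h1)).trans_lt hw'.1) (lt_irrefl _)

lemma eq_of_prefix_of_prefix (hρ : IsWordWeight ρ A δ C) {u : ℝ} {w w' s : List I}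
    (hw : w ∈ cutSet ρ u) (hw' : w' ∈ cutSet ρ u) (h : w <+: s) (h' : w' <+: s) : w = w' := by
  rcases List.prefix_or_prefix_of_prefix h h' with h | h
  · exact hρ.eq_of_prefix hw hw' h
  · exact (hρ.eq_of_prefix hw' hw h).symm

lemma exists_prefix_mem_cutSet (hρ : IsWordWeight ρ A δ C) {u : ℝ} (hu : 0 < u) {w : List I}
    (hw : u ≤ ρ w) : ∃ w₀ ∈ cutSet ρ u, w₀ <+: w := by
  induction w using List.reverseRecOn with
  | nil => rw [hρ.nil] at hw; linarith
  | append_singleton w i ih =>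
    rcases lt_or_ge (ρ w) u with h | h
    · exact ⟨w ++ [i], ⟨by simpa using h, hw⟩, List.prefix_rfl⟩
    · obtain ⟨w₀, h₀, hp⟩ := ih h
      exact ⟨w₀, h₀, hp.trans (List.prefix_append _ _)⟩

lemma exists_mem_cutSet_of_prefix (hρ : IsWordWeight ρ A δ C) [Nonempty I] {u : ℝ} (hu : 0 < u)
    {w : List I} (hw : ρ w.dropLast < u) : ∃ w' ∈ cutSet ρ u, w <+: w' := by
  rcases le_or_gt u (ρ w) with h | h
  · exact ⟨w, ⟨hw, h⟩, List.prefix_rfl⟩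
  · obtain ⟨i⟩ := ‹Nonempty I›
    obtain ⟨n, hn⟩ := exists_nat_ge (u / δ)
    rw [div_le_iff₀ hρ.step_pos] at hn
    have h1 : u ≤ ρ (w ++ List.replicate n i) := by
      have := hρ.superadd w (List.replicate n i)
      have h2 := hρ.length_le (List.replicate n i)
      rw [List.length_replicate] at h2
      linarith [hρ.nonneg w]
    obtain ⟨w', hw', hp⟩ := hρ.exists_prefix_mem_cutSet hu h1
    refine ⟨w', hw', ?_⟩
    rcases List.prefix_or_prefix_of_prefix hp (List.prefix_append w _) with h2 | h2
    · exact absurd (hw'.2.trans (hρ.mono h2)) (not_le.2 h)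
    · exact h2

lemma cutSet_nonempty (hρ : IsWordWeight ρ A δ C) [Nonempty I] {u : ℝ} (hu : 0 < u) :
    (cutSet ρ u).Nonempty := by
  obtain ⟨w, hw, -⟩ := hρ.exists_mem_cutSet_of_prefix hu (w := []) (by simpa [hρ.nil] using hu)
  exact ⟨w, hw⟩

lemma exists_le_of_nonneg (hρ : IsWordWeight ρ A δ C) [Nonempty I] {z : ℝ} (hz : 0 ≤ z) :
    ∃ w, z - C ≤ ρ w ∧ ρ w ≤ z := by
  rcases hz.eq_or_lt with rfl | hz
  · refine ⟨[], ?_, hρ.nil.le⟩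
    rw [hρ.nil]
    linarith [hρ.step_le, hρ.step_pos, hρ.defect_nonneg]
  · obtain ⟨w, hw⟩ := hρ.cutSet_nonempty hz
    exact ⟨w.dropLast, by linarith [hρ.le_dropLast_add (ne_nil_of_mem_cutSet hw), hw.2], hw.1.le⟩

/-- An antichain of words which have not yet passed the level `u` extends injectively to words of
the cut set at level `u`. -/
lemma exists_injOn_cutSet (hρ : IsWordWeight ρ A δ C) [Nonempty I] {u : ℝ} (hu : 0 < u)
    {S : Set (List I)} (hS : ∀ w ∈ S, ∀ w' ∈ S, w <+: w' → w = w')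
    (hlt : ∀ w ∈ S, ρ w.dropLast < u) :
    ∃ g : List I → List I, (∀ w ∈ S, g w ∈ cutSet ρ u ∧ w <+: g w) ∧ InjOn g S := by
  have h := fun w (hw : w ∈ S) => hρ.exists_mem_cutSet_of_prefix hu (hlt w hw)
  choose! g hg using h
  refine ⟨g, hg, fun w hw w' hw' e => ?_⟩
  have h1 := (hg w hw).2
  rw [e] at h1
  rcases List.prefix_or_prefix_of_prefix h1 (hg w' hw').2 with h | h
  · exact hS w hw w' hw' h
  · exact (hS w' hw' w hw h).symm

lemma ncard_le_of_antichain (hρ : IsWordWeight ρ A δ C) [Finite I] [Nonempty I] {u : ℝ}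
    (hu : 0 < u) {S : Set (List I)} (hS : ∀ w ∈ S, ∀ w' ∈ S, w <+: w' → w = w')
    (hlt : ∀ w ∈ S, ρ w.dropLast < u) : S.ncard ≤ (cutSet ρ u).ncard := by
  obtain ⟨g, hg, hinj⟩ := hρ.exists_injOn_cutSet hu hS hlt
  exact ncard_le_ncard_of_injOn g (fun w hw => (hg w hw).1) hinj (hρ.finite_cutSet u)

lemma ncard_cutSet_mono (hρ : IsWordWeight ρ A δ C) [Finite I] [Nonempty I] {u u' : ℝ}
    (h : u ≤ u') : (cutSet ρ u).ncard ≤ (cutSet ρ u').ncard := by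
  rcases le_or_gt u' 0 with h0 | h0
  · simp [hρ.cutSet_eq_empty (h.trans h0)]
  · exact hρ.ncard_le_of_antichain h0 (fun w hw w' hw' => hρ.eq_of_prefix hw hw')
      fun w hw => hw.1.trans_le h

lemma one_le_ncard_cutSet (hρ : IsWordWeight ρ A δ C) [Finite I] [Nonempty I] {u : ℝ}
    (hu : 0 < u) : 1 ≤ (cutSet ρ u).ncard :=
  (ncard_pos (hρ.finite_cutSet u)).2 (hρ.cutSet_nonempty hu)

lemma dropLast_append_lt (hρ : IsWordWeight ρ A δ C) {u t : ℝ} {w w' : List I}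
    (hw' : w' ∈ cutSet ρ t) (h : ρ w + t + A ≤ u) : ρ (w ++ w').dropLast < u := by
  rw [List.dropLast_append_of_ne_nil (ne_nil_of_mem_cutSet hw')]
  linarith [hρ.subadd w w'.dropLast, hw'.1]

lemma ncard_cutSet_le_ncard_extensions (hρ : IsWordWeight ρ A δ C) [Finite I] [Nonempty I]
    {w₀ : List I} {t u : ℝ} (ht : 0 < t) (h : ρ w₀ + t + A ≤ u) :
    (cutSet ρ t).ncard ≤ {w | w ∈ cutSet ρ u ∧ w₀ <+: w}.ncard := by
  have hu : 0 < u := by linarith [hρ.nonneg w₀, hρ.defect_nonneg]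
  obtain ⟨g, hg, hinj⟩ := hρ.exists_injOn_cutSet hu (S := (w₀ ++ ·) '' cutSet ρ t)
    (by
      rintro _ ⟨w, hw, rfl⟩ _ ⟨w', hw', rfl⟩ hp
      rw [hρ.eq_of_prefix hw hw' ((List.prefix_append_right_inj w₀).1 hp)])
    (by
      rintro _ ⟨w, hw, rfl⟩
      exact hρ.dropLast_append_lt hw h)
  rw [← ncard_image_of_injective (cutSet ρ t) (List.append_right_injective w₀)]
  refine ncard_le_ncard_of_injOn g (fun w hw => ⟨(hg w hw).1, ?_⟩) hinj
    ((hρ.finite_cutSet u).subset fun w hw => hw.1)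
  obtain ⟨w', hw', rfl⟩ := hw
  exact (List.prefix_append _ _).trans (hg _ ⟨w', hw', rfl⟩).2

lemma ncard_extensions_le (hρ : IsWordWeight ρ A δ C) [Finite I] [Nonempty I]
    {w₀ : List I} {v t : ℝ} (hw₀ : v ≤ ρ w₀) (h : v < t) :
    {w | w ∈ cutSet ρ t ∧ w₀ <+: w}.ncard ≤ (cutSet ρ (t - v)).ncard := by
  have e : {w | w ∈ cutSet ρ t ∧ w₀ <+: w} = (w₀ ++ ·) '' {w | w₀ ++ w ∈ cutSet ρ t} := by
    ext w
    constructor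
    · rintro ⟨hw, w', rfl⟩
      exact ⟨w', hw, rfl⟩
    · rintro ⟨w', hw, rfl⟩
      exact ⟨hw, List.prefix_append _ _⟩
  rw [e, ncard_image_of_injective _ (List.append_right_injective w₀)]
  refine hρ.ncard_le_of_antichain (sub_pos.2 h) ?_ ?_
  · intro w hw w' hw' hp
    exact List.append_cancel_left (hρ.eq_of_prefix hw hw' ((List.prefix_append_right_inj w₀).2 hp))
  · intro w hw
    rcases eq_or_ne w [] with rfl | hne
    · simpa [hρ.nil] using h
    · have h1 := hw.1
      rw [List.dropLast_append_of_ne_nil hne] at h1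
      linarith [hρ.superadd w₀ w.dropLast]

/-- Cut sets are supermultiplicative up to a bounded shift of the level. -/
lemma ncard_mul_ncard_le (hρ : IsWordWeight ρ A δ C) [Finite I] [Nonempty I] {s t : ℝ}
    (ht : 0 < t) :
    (cutSet ρ s).ncard * (cutSet ρ t).ncard ≤ (cutSet ρ (s + t + (C + A))).ncard := by
  rcases le_or_gt s 0 with hs | hs
  · simp [hρ.cutSet_eq_empty hs]
  have hinj : InjOn (fun p : List I × List I => p.1 ++ p.2) (cutSet ρ s ×ˢ cutSet ρ t) := by
    rintro ⟨a, b⟩ ⟨ha, hb⟩ ⟨a', b'⟩ ⟨ha', hb'⟩ e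
    dsimp only at ha hb ha' hb' e
    obtain rfl := hρ.eq_of_prefix_of_prefix ha ha' (List.prefix_append a b)
      (e ▸ List.prefix_append a' b')
    rw [List.append_cancel_left e]
  rw [← ncard_prod, ← hinj.ncard_image]
  have hC : 0 < C := by linarith [hρ.step_le, hρ.step_pos, hρ.defect_nonneg]
  refine hρ.ncard_le_of_antichain (by linarith [hρ.defect_nonneg]) ?_ ?_
  · rintro _ ⟨⟨a, b⟩, ⟨ha, hb⟩, rfl⟩ _ ⟨⟨a', b'⟩, ⟨ha', hb'⟩, rfl⟩ hp
    dsimp only at ha hb ha' hb' hp ⊢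
    obtain rfl := hρ.eq_of_prefix_of_prefix ha ha' ((List.prefix_append a b).trans hp)
      (List.prefix_append a' b')
    rw [hρ.eq_of_prefix hb hb' ((List.prefix_append_right_inj a).1 hp)]
  · rintro _ ⟨⟨a, b⟩, ⟨ha, hb⟩, rfl⟩
    exact hρ.dropLast_append_lt hb (by linarith [hρ.lt_add_of_mem_cutSet ha])

end IsWordWeight

/-! ### Growth rates of almost superadditive functions -/

/-- A form of Fekete's lemma over `[0, ∞)`, for functions which are superadditive up to the shift
`D` of the argument. The rate is the supremum of `a t / (t + D)`; it is attained in the limit because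
`a` is superadditive along the multiples of `t₀ + D`. -/
theorem exists_growth_rate {a : ℝ → ℝ} {D K : ℝ} (hD : 0 < D) (h0 : ∀ t, 0 ≤ t → 0 ≤ a t)
    (hmono : Monotone a) (hsup : ∀ s t, 0 ≤ s → 0 ≤ t → a s + a t ≤ a (s + t + D))
    (hK : ∀ t, 0 ≤ t → a t ≤ K * (t + D)) :
    ∃ h, 0 ≤ h ∧ (∀ t, 0 ≤ t → a t ≤ h * t + h * D) ∧
      ∀ ε > 0, ∃ L, ∀ t, 0 ≤ t → h * t ≤ a t + (ε * t + L) := by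
  have hbdd : BddAbove ((fun t => a t / (t + D)) '' Ici 0) := by
    refine ⟨K, ?_⟩
    rintro _ ⟨t, ht, rfl⟩
    rw [mem_Ici] at ht
    exact (div_le_iff₀ (by linarith)).2 (hK t ht)
  set h := sSup ((fun t => a t / (t + D)) '' Ici 0) with hh
  have hle : ∀ t, 0 ≤ t → a t / (t + D) ≤ h := fun t ht => le_csSup hbdd ⟨t, ht, rfl⟩
  have hnn : 0 ≤ h := (div_nonneg (h0 0 le_rfl) (by linarith)).trans (hle 0 le_rfl)
  refine ⟨h, hnn, fun t ht => ?_, fun ε hε => ?_⟩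
  · have := (div_le_iff₀ (by linarith)).1 (hle t ht)
    linarith
  · obtain ⟨_, ⟨t₀, ht₀, rfl⟩, hlt⟩ := exists_lt_of_lt_csSup
      ((nonempty_Ici (a := (0 : ℝ))).image fun t => a t / (t + D)) (sub_lt_self h hε)
    rw [mem_Ici] at ht₀
    have hp : 0 < t₀ + D := by linarith
    rw [lt_div_iff₀ hp] at hlt
    have hmul : ∀ n : ℕ, n * a t₀ ≤ a (n * (t₀ + D)) := by
      intro n
      induction n with
      | zero => simpa using h0 0 le_rfl
      | succ n ih =>
        have := hsup (n * (t₀ + D)) t₀ (by positivity) ht₀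
        push_cast
        rw [show (n + 1 : ℝ) * (t₀ + D) = n * (t₀ + D) + t₀ + D by ring]
        linarith
    refine ⟨a t₀, fun t ht => ?_⟩
    have h1 := Nat.floor_le (div_nonneg ht hp.le)
    have h2 := Nat.lt_floor_add_one (t / (t₀ + D))
    rw [le_div_iff₀ hp] at h1
    have h3 := (hmul ⌊t / (t₀ + D)⌋₊).trans (hmono h1)
    have h4 := h0 t₀ ht₀
    have h5 : t / (t₀ + D) * a t₀ ≤ a t + a t₀ := by nlinarith
    have h6 : (h - ε) * t ≤ t / (t₀ + D) * a t₀ := by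
      rw [div_mul_eq_mul_div, le_div_iff₀ hp]
      nlinarith
    linarith

/-! ### Consequences of a finite quasi-Assouad dimension -/

section QuasiAssouad

variable {X : Type*} [MetricSpace X] {α : ℝ}

lemma HasQuasiAssouadDim.exists_coverable (hX : HasQuasiAssouadDim X α) {σ θ₀ : ℝ} (hσ : α < σ)
    (hθ₀ : θ₀ < 1) :
    ∃ θ, θ₀ < θ ∧ θ < 1 ∧ ∃ s, 0 ≤ s ∧ s < σ ∧ ∃ c : ℝ, ∀ r R : ℝ, 0 < r → r ≤ r ^ θ → r ^ θ ≤ R →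
      R < 1 → ∀ x : X, Coverable univ (Metric.ball x R) r ((2 : ℝ) ^ c * (R / r) ^ s) := by
  have hσ0 : 0 < σ := hX.1.trans_lt hσ
  have h1 : ∀ᶠ θ in 𝓝[<] (1 : ℝ), quasiAssouadAt X θ < ENNReal.ofReal σ :=
    hX.2.eventually_lt_const ((ENNReal.ofReal_lt_ofReal_iff hσ0).2 hσ)
  have h2 : ∀ᶠ θ in 𝓝[<] (1 : ℝ), θ ∈ Ioo θ₀ 1 := Ioo_mem_nhdsLT hθ₀
  obtain ⟨θ, hlt, hθ, hθ1⟩ := (h1.and h2).exists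
  obtain ⟨a, ⟨s, hs0, rfl, C, hC, hcov⟩, hs⟩ := sInf_lt_iff.1 hlt
  refine ⟨θ, hθ, hθ1, s, hs0, (ENNReal.ofReal_lt_ofReal_iff hσ0).1 hs, Real.logb 2 C, ?_⟩
  intro r R hr h3 h4 h5 x
  rw [Real.rpow_logb two_pos (by norm_num) hC]
  have hR : 0 < R := (Real.rpow_pos_of_pos hr θ).trans_le h4
  exact (coverNum_le_iff (by positivity) _).1 (hcov r R hr h3 h4 h5 x)

lemma HasQuasiAssouadDim.coverable_univ [CompactSpace X] (hX : HasQuasiAssouadDim X α) {ε : ℝ}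
    (hε : 0 < ε) : ∃ K, ∀ t, 0 ≤ t →
      Coverable (univ : Set X) univ ((2 : ℝ) ^ (-t)) ((2 : ℝ) ^ ((α + ε) * t + K)) := by
  obtain ⟨θ, hθ0, hθ1, s, hs0, hs, c, hc⟩ :=
    hX.exists_coverable (σ := α + ε) (by linarith) zero_lt_one
  obtain ⟨b₀, -, hb₀⟩ := exists_coverable_of_isCompact (isCompact_univ (X := X))
    (r := (2 : ℝ) ^ (-1 : ℝ)) (by positivity)
  obtain ⟨b₁, hb₁0, hb₁⟩ := exists_coverable_of_isCompact (isCompact_univ (X := X))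
    (r := (2 : ℝ) ^ (-(max 1 (1 / θ)))) (by positivity)
  have hα := hX.1
  refine ⟨max b₁ (b₀ + c), fun t ht => ?_⟩
  rcases le_total t (max 1 (1 / θ)) with h | h
  · refine hb₁.mono le_rfl le_rfl (Real.rpow_le_rpow_of_exponent_le one_le_two (by linarith))
      (Real.rpow_le_rpow_of_exponent_le one_le_two ?_)
    have := le_max_left b₁ (b₀ + c)
    nlinarith
  · have ht1 : 1 ≤ t := (le_max_left _ _).trans h
    have ht2 : 1 ≤ t * θ := (div_le_iff₀ hθ0).1 ((le_max_right _ _).trans h)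
    refine (hb₀.trans (r := (2 : ℝ) ^ (-t)) (b' := (2 : ℝ) ^ (c + (t - 1) * s)) (by positivity)
      le_rfl fun x _ => ?_).mono le_rfl le_rfl le_rfl ?_
    · rw [univ_inter]
      refine (hc ((2 : ℝ) ^ (-t)) ((2 : ℝ) ^ (-1 : ℝ)) (by positivity) ?_ ?_ ?_ x).mono
        le_rfl le_rfl le_rfl ?_
      · rw [← Real.rpow_mul zero_le_two]
        exact Real.rpow_le_rpow_of_exponent_le one_le_two (by nlinarith)
      · rw [← Real.rpow_mul zero_le_two]
        exact Real.rpow_le_rpow_of_exponent_le one_le_two (by linarith)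
      · exact Real.rpow_lt_one_of_one_lt_of_neg one_lt_two (by norm_num)
      · rw [← Real.rpow_sub two_pos, ← Real.rpow_mul zero_le_two, ← Real.rpow_add two_pos]
        exact Real.rpow_le_rpow_of_exponent_le one_le_two (by linarith)
    · rw [← Real.rpow_add two_pos]
      refine Real.rpow_le_rpow_of_exponent_le one_le_two ?_
      have := le_max_right b₁ (b₀ + c)
      nlinarith

/-- Sets whose diameter is at most `2 ^ (-m)` up to a subexponential factor are covered by
subexponentially many balls of radius `2 ^ (-m)`. -/
theorem HasQuasiAssouadDim.exists_error_coverable [CompactSpace X] (hX : HasQuasiAssouadDim X α)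
    {η : ℝ → ℝ} (hη : IsErrorFunction η) :
    ∃ e, IsErrorFunction e ∧ ∀ m, 0 ≤ m → ∀ (x : X) (S : Set X),
      S ⊆ Metric.ball x ((2 : ℝ) ^ (-m + 1 + η m)) →
        Coverable S S ((2 : ℝ) ^ (-m)) ((2 : ℝ) ^ e m) := by
  have key := exists_isErrorFunction
    (ι := {i : ℝ × X × Set X // 0 ≤ i.1 ∧ i.2.2 ⊆ Metric.ball i.2.1 ((2 : ℝ) ^ (-i.1 + 1 + η i.1))})
    (fun i b => Coverable i.1.2.2 i.1.2.2 ((2 : ℝ) ^ (-i.1.1)) ((2 : ℝ) ^ b))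
    (fun i => i.1.1) (fun i => i.2.1)
    (fun i b b' hb h => h.mono le_rfl le_rfl le_rfl
      (Real.rpow_le_rpow_of_exponent_le one_le_two hb))
  refine (key ?_).imp fun e he => ⟨he.1, fun m hm x S hS => he.2 ⟨(m, x, S), hm, hS⟩⟩
  intro ε hε
  have hα := hX.1
  -- the exponent `θ` is so close to `1` that the scales `2 ^ (-θ m)` and `2 ^ (-m)` differ little
  obtain ⟨θ, hθ0, hθ1, s, hs0, hs, c, hc⟩ := hX.exists_coverable (σ := α + 1) (by linarith)
    (θ₀ := max 0 (1 - ε / (α + 1))) (max_lt one_pos (by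
      have : 0 < ε / (α + 1) := by positivity
      linarith))
  have hθ00 : 0 < θ := (le_max_left _ _).trans_lt hθ0
  have hθε : (1 - θ) * (α + 1) ≤ ε := by
    have := (le_max_right _ _).trans hθ0.le
    have h2 : 1 - θ ≤ ε / (α + 1) := by linarith
    rwa [le_div_iff₀ (by linarith)] at h2
  obtain ⟨L, hL0, hL⟩ := hη.exists_le_linear (ε := (1 - θ) / 2) (by linarith)
  set M : ℝ := (L + 2) / ((1 - θ) / 2) with hM
  obtain ⟨b₁, hb₁0, hb₁⟩ := exists_coverable_of_isCompact (isCompact_univ (X := X))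
    (r := (2 : ℝ) ^ (-(M + 1))) (by positivity)
  refine ⟨max b₁ (c + ε), ?_⟩
  rintro ⟨⟨m, x, S⟩, hm, hS⟩
  dsimp only at hm hS ⊢
  have hr : (2 : ℝ) ^ (-m) = 2 * (2 : ℝ) ^ (-(m + 1)) := by
    rw [two_mul_rpow_neg, add_sub_cancel_right]
  rw [hr]
  rcases le_total m M with h | h
  · refine Coverable.recenter (A := univ) (hb₁.mono le_rfl (subset_univ _)
      (Real.rpow_le_rpow_of_exponent_le one_le_two (by linarith))
      (Real.rpow_le_rpow_of_exponent_le one_le_two ?_))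
    have := le_max_left b₁ (c + ε)
    nlinarith
  · rw [hM, div_le_iff₀ (by linarith)] at h
    refine Coverable.recenter (A := univ) ((hc ((2 : ℝ) ^ (-(m + 1)))
      (((2 : ℝ) ^ (-(m + 1))) ^ θ) (by positivity) ?_ le_rfl ?_ x).mono le_rfl (hS.trans ?_)
      le_rfl ?_)
    · rw [← Real.rpow_mul zero_le_two]
      exact Real.rpow_le_rpow_of_exponent_le one_le_two (by nlinarith)
    · rw [← Real.rpow_mul zero_le_two]
      exact Real.rpow_lt_one_of_one_lt_of_neg one_lt_two (by nlinarith)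
    · rw [← Real.rpow_mul zero_le_two]
      refine Metric.ball_subset_ball (Real.rpow_le_rpow_of_exponent_le one_le_two ?_)
      have := hL m hm
      nlinarith
    · rw [← Real.rpow_mul zero_le_two, ← Real.rpow_sub two_pos, ← Real.rpow_mul zero_le_two,
        ← Real.rpow_add two_pos]
      refine Real.rpow_le_rpow_of_exponent_le one_le_two ?_
      have h1 := le_max_right b₁ (c + ε)
      have h2 : (1 - θ) * s ≤ ε := le_trans (mul_le_mul_of_nonneg_left hs.le (by linarith)) hθε
      nlinarith

end QuasiAssouad

/-! ### Counting cylinders -/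

section Counting

lemma wordMap_append {X I : Type*} (f : I → X → X) (w w' : List I) :
    wordMap f (w ++ w') = wordMap f w ∘ wordMap f w' := by
  induction w with
  | nil => rfl
  | cons i w ih => simp only [List.cons_append, wordMap, ih, Function.comp_assoc]

lemma range_wordMap_subset {X I : Type*} {f : I → X → X} {w w' : List I} (h : w <+: w') :
    range (wordMap f w') ⊆ range (wordMap f w) := by
  obtain ⟨s, rfl⟩ := h
  rw [wordMap_append]
  exact range_comp_subset_range _ _

variable {X I : Type*} [MetricSpace X] {f : I → X → X} {ρ : List I → ℝ} {A δ C : ℝ}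

lemma finite_cutSetNear [Finite I] (hρ : IsWordWeight ρ A δ C) (x : X) (u : ℝ) :
    (cutSetNear f ρ x u).Finite :=
  (hρ.finite_cutSet u).subset fun _ hw => hw.1

lemma IsAsymptoticallyBounded.exists_error [Finite I] [Nonempty I]
    (hb : IsAsymptoticallyBounded f ρ) (hρ : IsWordWeight ρ A δ C) :
    ∃ e, IsErrorFunction e ∧ ∀ u, 0 ≤ u → ∀ x : X,
      ((cutSetNear f ρ x u).ncard : ℝ) ≤ (2 : ℝ) ^ e u := by
  have key := exists_isErrorFunction (ι := {u : ℝ // 0 ≤ u} × X)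
    (fun i b => ((cutSetNear f ρ i.2 i.1).ncard : ℝ) ≤ (2 : ℝ) ^ b) (fun i => i.1.1)
    (fun i => i.1.2)
    (fun i b b' hb h => h.trans (Real.rpow_le_rpow_of_exponent_le one_le_two hb))
  refine (key ?_).imp fun e he => ⟨he.1, fun u hu x => he.2 (⟨u, hu⟩, x)⟩
  intro ε hε
  have hle : ∀ u x, (cutSetNear f ρ x u).ncard ≤ (cutSet ρ u).ncard := fun u x =>
    ncard_le_ncard (fun _ hw => hw.1) (hρ.finite_cutSet u)
  have h1 : ∀ᶠ u in atTop, Real.logb 2 (⨆ x : X, ((cutSetNear f ρ x u).ncard : ℝ)) / u < ε :=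
    Tendsto.eventually_lt_const hε hb
  obtain ⟨U, hU⟩ := (h1.and (eventually_gt_atTop 0)).exists_forall_of_atTop
  refine ⟨(cutSet ρ U).ncard, ?_⟩
  rintro ⟨⟨u, hu⟩, x⟩
  dsimp only
  rcases le_total U u with h | h
  · obtain ⟨h2, h3⟩ := hU u h
    rw [div_lt_iff₀ h3] at h2
    have h4 : ((cutSetNear f ρ x u).ncard : ℝ) ≤ ⨆ x : X, ((cutSetNear f ρ x u).ncard : ℝ) :=
      le_ciSup (f := fun x : X => ((cutSetNear f ρ x u).ncard : ℝ))
        ⟨(cutSet ρ u).ncard, by rintro _ ⟨y, rfl⟩; exact Nat.cast_le.2 (hle u y)⟩ x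
    have h5 : (⨆ x : X, ((cutSetNear f ρ x u).ncard : ℝ)) ≤ (2 : ℝ) ^ (ε * u) := by
      rcases le_or_gt (⨆ x : X, ((cutSetNear f ρ x u).ncard : ℝ)) 0 with h6 | h6
      · exact h6.trans (by positivity)
      · exact ((Real.logb_lt_iff_lt_rpow one_lt_two h6).1 h2).le
    refine (h4.trans h5).trans (Real.rpow_le_rpow_of_exponent_le one_le_two ?_)
    have : (0 : ℝ) ≤ (cutSet ρ U).ncard := by positivity
    linarith
  · have h2 := (hle u x).trans (hρ.ncard_cutSet_mono h)
    have h3 : ((cutSet ρ U).ncard : ℝ) ≤ (2 : ℝ) ^ ((cutSet ρ U).ncard : ℝ) := by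
      rw [Real.rpow_natCast]
      exact_mod_cast Nat.lt_two_pow_self.le
    refine le_trans (by exact_mod_cast h2) (h3.trans
      (Real.rpow_le_rpow_of_exponent_le one_le_two ?_))
    have : 0 ≤ ε * u := by positivity
    linarith

lemma ncard_biUnion_le {ι β : Type*} {s : Set ι} (hs : s.Finite) {t : ι → Set β}
    (ht : ∀ i ∈ s, (t i).Finite) {n : ℝ} (hn : ∀ i ∈ s, ((t i).ncard : ℝ) ≤ n) :
    ((⋃ i ∈ s, t i).ncard : ℝ) ≤ s.ncard * n := by
  classical
  induction s, hs using Set.Finite.induction_on with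
  | empty => simp
  | @insert a s ha hs ih =>
    rw [biUnion_insert, ncard_insert_of_notMem ha hs]
    have h1 := ncard_union_le (t a) (⋃ i ∈ s, t i)
    have h2 := ih (fun i hi => ht i (mem_insert_of_mem _ hi))
      fun i hi => hn i (mem_insert_of_mem _ hi)
    have h3 := hn a (mem_insert _ _)
    have h4 : ((t a ∪ ⋃ i ∈ s, t i).ncard : ℝ) ≤ (t a).ncard + (⋃ i ∈ s, t i).ncard := by
      exact_mod_cast h1
    push_cast
    linarith

/-- The critical exponent exists and is bounded by the quasi-Assouad dimension of the ambient
space: the cylinders of the cut set at level `u` all meet balls of a cover of `X` by balls of radius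
`2 ^ (-u)`, each of which meets only subexponentially many. -/
theorem exists_criticalExponent [CompactSpace X] [Nonempty X] [Finite I] [Nonempty I] {α : ℝ}
    (hX : HasQuasiAssouadDim X α) (hρ : IsWordWeight ρ A δ C) (hb : IsAsymptoticallyBounded f ρ) :
    ∃ h, IsCriticalExponent ρ h ∧ 0 ≤ h ∧ h ≤ α ∧ ∃ e, IsErrorFunction e ∧ ∀ t, 0 < t →
      ((cutSet ρ t).ncard : ℝ) ≤ (2 : ℝ) ^ (h * t + e t) ∧
      (2 : ℝ) ^ (h * t - e t) ≤ ((cutSet ρ t).ncard : ℝ) := by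
  set a : ℝ → ℝ := fun t => Real.logb 2 ((cutSet ρ t).ncard : ℝ) with ha
  have hA := hρ.defect_nonneg
  have hα := hX.1
  have hC : 0 < C := by linarith [hρ.step_le, hρ.step_pos]
  have hnn : ∀ t, 0 ≤ a t := fun t => by
    rcases Nat.eq_zero_or_pos (cutSet ρ t).ncard with h | h
    · simp [ha, h]
    · exact Real.logb_nonneg one_lt_two (by exact_mod_cast h)
  have hmono : Monotone a := fun s t hst => by
    rcases Nat.eq_zero_or_pos (cutSet ρ s).ncard with h | h
    · have : a s = 0 := by simp [ha, h]
      rw [this]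
      exact hnn t
    · exact Real.logb_le_logb_of_le one_lt_two (by exact_mod_cast h)
        (by exact_mod_cast hρ.ncard_cutSet_mono hst)
  have hpos : ∀ t, 0 < t → (0 : ℝ) < (cutSet ρ t).ncard := fun t ht => by
    exact_mod_cast hρ.one_le_ncard_cutSet ht
  have hzero : a 0 = 0 := by simp [ha, hρ.cutSet_eq_empty le_rfl]
  have hsup : ∀ s t, 0 ≤ s → 0 ≤ t → a s + a t ≤ a (s + t + (C + A)) := by
    intro s t hs ht
    rcases hs.eq_or_lt with rfl | hs
    · rw [hzero, zero_add]
      exact hmono (by linarith)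
    rcases ht.eq_or_lt with rfl | ht
    · rw [hzero, add_zero]
      exact hmono (by linarith)
    rw [ha]
    dsimp only
    rw [← Real.logb_mul (hpos s hs).ne' (hpos t ht).ne']
    exact Real.logb_le_logb_of_le one_lt_two (mul_pos (hpos s hs) (hpos t ht))
      (by exact_mod_cast hρ.ncard_mul_ncard_le ht)
  obtain ⟨e₂, he₂, hnear⟩ := hb.exists_error hρ
  have hup : ∀ ε > 0, ∃ K, ∀ t, 0 < t → a t ≤ (α + ε) * t + K := by
    intro ε hε
    obtain ⟨K₁, hK₁⟩ := hX.coverable_univ (half_pos hε)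
    obtain ⟨K₂, -, hK₂⟩ := he₂.exists_le_linear (half_pos hε)
    refine ⟨K₁ + K₂, fun t ht => ?_⟩
    obtain ⟨T, -, hT, hc⟩ := hK₁ t ht.le
    have hsub : cutSet ρ t ⊆ ⋃ x ∈ (T : Set X), cutSetNear f ρ x t := by
      intro w hw
      obtain ⟨y⟩ := ‹Nonempty X›
      have := hT (mem_univ (wordMap f w y))
      simp only [mem_iUnion] at this ⊢
      obtain ⟨x, hx, hxy⟩ := this
      exact ⟨x, hx, hw, _, mem_range_self y, hxy⟩
    have hfin : ∀ x ∈ (T : Set X), (cutSetNear f ρ x t).Finite := fun x _ =>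
      finite_cutSetNear hρ x t
    have h1 := ncard_le_ncard hsub (T.finite_toSet.biUnion hfin)
    have h2 := ncard_biUnion_le T.finite_toSet hfin fun x _ => hnear t ht.le x
    rw [ncard_coe_finset] at h2
    rw [ha]
    dsimp only
    rw [Real.logb_le_iff_le_rpow one_lt_two (hpos t ht)]
    calc ((cutSet ρ t).ncard : ℝ) ≤ T.card * (2 : ℝ) ^ e₂ t := le_trans (by exact_mod_cast h1) h2
      _ ≤ (2 : ℝ) ^ ((α + ε / 2) * t + K₁) * (2 : ℝ) ^ e₂ t := by gcongr
      _ = (2 : ℝ) ^ ((α + ε / 2) * t + K₁ + e₂ t) := by rw [Real.rpow_add two_pos _ (e₂ t)]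
      _ ≤ _ := Real.rpow_le_rpow_of_exponent_le one_le_two (by linarith [hK₂ t ht.le])
  obtain ⟨K, hK⟩ := hup 1 one_pos
  obtain ⟨h, hh0, hle, hge⟩ := exists_growth_rate (a := a) (D := C + A)
    (K := max (α + 1) (K / (C + A))) (by linarith) (fun t _ => hnn t) hmono hsup (fun t ht => by
      have h1 := le_max_left (α + 1) (K / (C + A))
      have h2 := le_max_right (α + 1) (K / (C + A))
      rw [div_le_iff₀ (by linarith)] at h2
      rcases ht.eq_or_lt with rfl | ht
      · rw [hzero]
        have : 0 ≤ max (α + 1) (K / (C + A)) := by linarith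
        positivity
      · have := hK t ht
        nlinarith)
  have hhα : h ≤ α := by
    refine le_of_forall_pos_le_add fun ε hε => ?_
    by_contra! hlt
    obtain ⟨K₁, hK₁⟩ := hup (ε / 2) (by linarith)
    obtain ⟨L, hL⟩ := hge (ε / 2) (by linarith)
    set t := (max (K₁ + L) 0 + 1) / (h - (α + ε)) with ht
    have hpos' : 0 < h - (α + ε) := by linarith
    have ht0 : 0 < t := by positivity
    have h1 := hK₁ t ht0
    have h2 := hL t ht0.le
    have h3 : t * (h - (α + ε)) = max (K₁ + L) 0 + 1 := div_mul_cancel₀ _ hpos'.ne'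
    have := le_max_left (K₁ + L) 0
    nlinarith
  obtain ⟨e, he, hea⟩ := exists_isErrorFunction (ι := {t : ℝ // 0 ≤ t})
    (fun t b => a t ≤ h * t + b ∧ h * t - b ≤ a t) (fun t => t.1) (fun t => t.2)
    (fun t b b' hb h => ⟨by linarith [h.1], by linarith [h.2]⟩) (by
      intro ε hε
      obtain ⟨L, hL⟩ := hge ε hε
      refine ⟨max L (h * (C + A)), fun ⟨t, ht⟩ => ?_⟩
      have h1 := le_max_left L (h * (C + A))
      have h2 := le_max_right L (h * (C + A))
      have h3 : 0 ≤ ε * t := by positivity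
      exact ⟨by linarith [hle t ht], by linarith [hL t ht]⟩)
  refine ⟨h, ?_, hh0, hhα, e, he, fun t ht => ?_⟩
  · have hl : Tendsto (fun t => h - e t / t) atTop (𝓝 h) := by
      simpa using tendsto_const_nhds.sub he.tendsto
    have hr : Tendsto (fun t => h + e t / t) atTop (𝓝 h) := by
      simpa using tendsto_const_nhds.add he.tendsto
    refine tendsto_of_tendsto_of_tendsto_of_le_of_le' hl hr ?_ ?_
    · filter_upwards [eventually_gt_atTop 0] with t ht
      rw [le_div_iff₀ ht, sub_mul, div_mul_cancel₀ _ ht.ne']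
      exact (hea ⟨t, ht.le⟩).2
    · filter_upwards [eventually_gt_atTop 0] with t ht
      rw [div_le_iff₀ ht, add_mul, div_mul_cancel₀ _ ht.ne']
      exact (hea ⟨t, ht.le⟩).1
  · obtain ⟨h1, h2⟩ := hea ⟨t, ht.le⟩
    exact ⟨(Real.logb_le_iff_le_rpow one_lt_two (hpos t ht)).1 h1,
      (Real.le_logb_iff_rpow_le one_lt_two (hpos t ht)).1 h2⟩

/-- The number of cylinders of level `t` meeting a ball of radius `2 ^ (-v)`. If `t > v`, each of
them extends one of the few cylinders of level `v` meeting the ball, and a cylinder of level `v` has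
at most as many extensions as there are words in the cut set at level `t - v`. -/
theorem ncard_near_le [Finite I] [Nonempty I] (hρ : IsWordWeight ρ A δ C) {h : ℝ}
    {e e' : ℝ → ℝ} (he : IsErrorFunction e) (he' : IsErrorFunction e')
    (hcard : ∀ t, 0 < t → ((cutSet ρ t).ncard : ℝ) ≤ (2 : ℝ) ^ (h * t + e t))
    (hnear : ∀ u, 0 ≤ u → ∀ x : X, ((cutSetNear f ρ x u).ncard : ℝ) ≤ (2 : ℝ) ^ e' u)
    {t v : ℝ} (ht : 0 < t) (hv : 0 ≤ v) (x : X) :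
    ({w | w ∈ cutSet ρ t ∧ (range (wordMap f w) ∩ Metric.ball x ((2 : ℝ) ^ (-v))).Nonempty}.ncard
      : ℝ) ≤ (2 : ℝ) ^ (h * max (t - v) 0 + (e t + e' t)) := by
  rcases le_or_gt t v with htv | hvt
  · have h1 : {w | w ∈ cutSet ρ t ∧ (range (wordMap f w) ∩
        Metric.ball x ((2 : ℝ) ^ (-v))).Nonempty} ⊆ cutSetNear f ρ x t := fun w hw =>
      ⟨hw.1, hw.2.mono (inter_subset_inter_right _ (Metric.ball_subset_ball
        (Real.rpow_le_rpow_of_exponent_le one_le_two (by linarith))))⟩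
    have h2 := ncard_le_ncard h1 (finite_cutSetNear hρ x t)
    refine le_trans (by exact_mod_cast h2) ((hnear t ht.le x).trans
      (Real.rpow_le_rpow_of_exponent_le one_le_two ?_))
    rw [max_eq_right (by linarith)]
    linarith [he.nonneg t ht.le]
  rw [max_eq_left (by linarith)]
  rcases hv.eq_or_lt with rfl | hv
  · have h1 := ncard_le_ncard (s := {w | w ∈ cutSet ρ t ∧ (range (wordMap f w) ∩
        Metric.ball x ((2 : ℝ) ^ (-(0 : ℝ)))).Nonempty}) (fun w hw => hw.1) (hρ.finite_cutSet t)
    refine le_trans (by exact_mod_cast h1) ((hcard t ht).trans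
      (Real.rpow_le_rpow_of_exponent_le one_le_two ?_))
    linarith [he'.nonneg t ht.le]
  · have hfin : ∀ w₀ ∈ cutSetNear f ρ x v, {w | w ∈ cutSet ρ t ∧ w₀ <+: w}.Finite := fun w₀ _ =>
      (hρ.finite_cutSet t).subset fun w hw => hw.1
    have h1 : {w | w ∈ cutSet ρ t ∧ (range (wordMap f w) ∩
        Metric.ball x ((2 : ℝ) ^ (-v))).Nonempty} ⊆
        ⋃ w₀ ∈ cutSetNear f ρ x v, {w | w ∈ cutSet ρ t ∧ w₀ <+: w} := by
      intro w hw
      obtain ⟨w₀, hw₀, hp⟩ := hρ.exists_prefix_mem_cutSet hv (hvt.le.trans hw.1.2)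
      exact mem_biUnion (show w₀ ∈ cutSetNear f ρ x v from
        ⟨hw₀, hw.2.mono (inter_subset_inter_left _ (range_wordMap_subset hp))⟩) ⟨hw.1, hp⟩
    have hN := finite_cutSetNear (f := f) hρ x v
    have h2 := ncard_le_ncard h1 (hN.biUnion hfin)
    have h3 := ncard_biUnion_le hN hfin (n := (2 : ℝ) ^ (h * (t - v) + e (t - v))) fun w₀ hw₀ =>
      le_trans (by exact_mod_cast hρ.ncard_extensions_le hw₀.1.2 hvt) (hcard _ (by linarith))
    refine le_trans (by exact_mod_cast h2) (h3.trans ?_)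
    calc ((cutSetNear f ρ x v).ncard : ℝ) * (2 : ℝ) ^ (h * (t - v) + e (t - v))
        ≤ (2 : ℝ) ^ e' v * (2 : ℝ) ^ (h * (t - v) + e (t - v)) := by gcongr; exact hnear v hv.le x
      _ = (2 : ℝ) ^ (e' v + (h * (t - v) + e (t - v))) := by rw [← Real.rpow_add two_pos]
      _ ≤ _ := by
        refine Real.rpow_le_rpow_of_exponent_le one_le_two ?_
        have h4 := he'.mono (mem_Ici.2 hv.le) (mem_Ici.2 ht.le) hvt.le
        have h5 := he.mono (mem_Ici.2 (sub_nonneg.2 hvt.le)) (mem_Ici.2 ht.le)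
          (show t - v ≤ t by linarith)
        linarith

end Counting

/-! ### Inhomogeneous attractors and their pieces -/

section Attractor

variable {X I : Type*} [MetricSpace X] {f : I → X → X} {F Λ : Set X}

lemma continuous_wordMap (hf : ∀ i, Continuous (f i)) (w : List I) : Continuous (wordMap f w) := by
  induction w with
  | nil => exact continuous_id
  | cons i w ih => exact (hf i).comp ih

lemma IsInhomogeneousAttractor.condensation_subset (hΛ : IsInhomogeneousAttractor f F Λ) :
    F ⊆ Λ := by
  rw [hΛ.invariant]
  exact subset_union_left

lemma IsInhomogeneousAttractor.image_subset (hΛ : IsInhomogeneousAttractor f F Λ) (w : List I) :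
    wordMap f w '' Λ ⊆ Λ := by
  induction w with
  | nil => simp [wordMap]
  | cons i w ih =>
    rw [wordMap, image_comp]
    refine (image_mono ih).trans ?_
    conv_rhs => rw [hΛ.invariant]
    exact (subset_iUnion (fun i => f i '' Λ) i).trans subset_union_right

lemma IsInhomogeneousAttractor.image_condensation_subset (hΛ : IsInhomogeneousAttractor f F Λ)
    (w : List I) : wordMap f w '' F ⊆ Λ :=
  (image_mono hΛ.condensation_subset).trans (hΛ.image_subset w)

/-- At every level `u`, the attractor consists of images of the condensation set under words of
weight less than `u` and of cylinders of the cut set at level `u`. -/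
lemma IsInhomogeneousAttractor.exists_piece (hΛ : IsInhomogeneousAttractor f F Λ)
    {ρ : List I → ℝ} {A δ C : ℝ} (hρ : IsWordWeight ρ A δ C) {u : ℝ} (hu : 0 < u) {x : X}
    (hx : x ∈ Λ) :
    (∃ w, ρ w < u ∧ x ∈ wordMap f w '' F) ∨ ∃ w ∈ cutSet ρ u, x ∈ wordMap f w '' Λ := by
  by_contra! hcon
  obtain ⟨h1, h2⟩ := hcon
  have key : ∀ n : ℕ, ∃ w : List I, w.length = n ∧ ρ w < u ∧ x ∈ wordMap f w '' Λ := by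
    intro n
    induction n with
    | zero => exact ⟨[], rfl, by rwa [hρ.nil], x, hx, rfl⟩
    | succ n ih =>
      obtain ⟨w, hn, hw, y, hy, hyx⟩ := ih
      rw [hΛ.invariant] at hy
      rcases hy with hy | hy
      · exact absurd ⟨y, hy, hyx⟩ (h1 w hw)
      · obtain ⟨i, y', hy', rfl⟩ := mem_iUnion.1 hy
        have hmem : x ∈ wordMap f (w ++ [i]) '' Λ := ⟨y', hy', by
          rw [wordMap_append]
          exact hyx⟩
        refine ⟨w ++ [i], by simp [hn], ?_, hmem⟩
        by_contra! hge
        exact h2 (w ++ [i]) ⟨by simpa using hw, hge⟩ hmem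
  obtain ⟨n, hn⟩ := exists_nat_ge (u / δ)
  rw [div_le_iff₀ hρ.step_pos] at hn
  obtain ⟨w, hw, hlt, -⟩ := key n
  have := hρ.length_le w
  rw [hw] at this
  linarith

end Attractor

lemma br_le_br_of_subset {X : Type*} [MetricSpace X] {S T : Set X} (hS : IsCompact S)
    (hSne : S.Nonempty) (hT : IsCompact T) (hST : S ⊆ T) (u v : ℝ) :
    br S (u - 1) v ≤ br T u v := by
  refine (br_le_iff hS hSne).2 fun x hx => ?_
  have h := (coverable_br hT (hSne.mono hST) u v x (hST hx)).mono le_rfl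
    (inter_subset_inter_left _ hST) le_rfl le_rfl
  rw [← two_mul_rpow_neg]
  exact h.recenter.mono inter_subset_left le_rfl le_rfl le_rfl

/-- The quantitative consequences of the assumptions on an inhomogeneous attractor, with a single
error function `e` for all of them: `piece` compares the branching functions of the images of the
condensation set with `ψ`; `card_le`, `le_card` and `near` count cylinders; `small` and `small_ball`
say that sets of diameter about `2 ^ (-m)` are covered by few balls of radius `2 ^ (-m)`. -/
structure IsBranchingModel {X I : Type*} [MetricSpace X] (f : I → X → X) (F Λ : Set X)
    (ρ : List I → ℝ) (ψ : Delta → ℝ) (h α A δ C : ℝ) (e : ℝ → ℝ) : Prop where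
  err : IsErrorFunction e
  weight : IsWordWeight ρ A δ C
  isB : IsB α ψ
  exponent_nonneg : 0 ≤ h
  exponent_le : h ≤ α
  continuous : ∀ w, Continuous (wordMap f w)
  isCompact : IsCompact F
  nonempty : F.Nonempty
  attractor : IsInhomogeneousAttractor f F Λ
  piece : ∀ (w : List I) (u v : ℝ) (hv : 0 ≤ v) (hvu : v ≤ u),
    |br (wordMap f w '' F) (u + ρ w) (v + ρ w) - ψ ⟨(u, v), hv, hvu⟩| ≤ e (u + ρ w)
  diam : ∀ (w : List I) (x y : X),
    dist (wordMap f w x) (wordMap f w y) ≤ (2 : ℝ) ^ (e (ρ w) - ρ w)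
  card_le : ∀ t, 0 < t → ((cutSet ρ t).ncard : ℝ) ≤ (2 : ℝ) ^ (h * t + e t)
  le_card : ∀ t, 0 < t → (2 : ℝ) ^ (h * t - e t) ≤ ((cutSet ρ t).ncard : ℝ)
  near : ∀ u, 0 ≤ u → ∀ x : X, ((cutSetNear f ρ x u).ncard : ℝ) ≤ (2 : ℝ) ^ e u
  small : ∀ m, 0 ≤ m → ∀ w : List I, m ≤ ρ w → ρ w ≤ m + C → ∀ S ⊆ range (wordMap f w),
    Coverable S S ((2 : ℝ) ^ (-m)) ((2 : ℝ) ^ e m)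
  small_ball : ∀ m, 0 ≤ m → ∀ (x : X), ∀ S ⊆ Metric.ball x ((2 : ℝ) ^ (-m)),
    Coverable S S ((2 : ℝ) ^ (-m)) ((2 : ℝ) ^ e m)

namespace IsBranchingModel

variable {X I : Type*} [MetricSpace X] {f : I → X → X} {F Λ : Set X}
  {ρ : List I → ℝ} {ψ : Delta → ℝ} {h α A δ C : ℝ} {e : ℝ → ℝ}

/-! ### The lower bound -/

/-- An image of the condensation set under a word of weight about `z` contributes
`ψ (u - z, v - z)`. -/
lemma le_br_of_le [Nonempty I] (d : IsBranchingModel f F Λ ρ ψ h α A δ C e)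
    {u v z : ℝ} (hz : 0 ≤ z) (hzv : z ≤ v) (hvu : v ≤ u) :
    ψ ⟨(u - z, v - z), sub_nonneg.2 hzv, sub_le_sub_right hvu z⟩ ≤
      br Λ u v + (e u + α * (2 * C + 1)) := by
  have hα : 0 ≤ α := d.exponent_nonneg.trans d.exponent_le
  have hC : 0 < C := by linarith [d.weight.step_le, d.weight.step_pos, d.weight.defect_nonneg]
  have hbr := br_nonneg d.attractor.nonempty u v
  have heu := d.err.nonneg u (by linarith)
  rcases lt_or_ge (u - 1) v with h1 | h1
  · have h2 := d.isB.lipschitz_of_le (d := 1) (u := u - z) (v := v - z) (u' := v - z)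
      (v' := v - z) (by linarith) (by linarith) (by linarith) le_rfl hα
      (by rw [sub_self, abs_zero, abs_of_nonneg (by linarith)]; linarith)
    rw [d.isB.diag (v - z) (by linarith)] at h2
    have : 0 ≤ α * C := by positivity
    linarith
  -- passing from `f_w(F)` to `Λ` costs a factor `2` in the radius, hence the shift of `u` by `1`
  · obtain ⟨w, hw1, hw2⟩ := d.weight.exists_le_of_nonneg hz
    have h2 := (abs_le.1 (d.piece w (u - 1 - ρ w) (v - ρ w) (by linarith) (by linarith))).1
    simp only [sub_add_cancel] at h2
    have h3 := br_le_br_of_subset (d.isCompact.image (d.continuous w)) (d.nonempty.image _)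
      d.attractor.isCompact (d.attractor.image_condensation_subset w) u v
    have h4 := d.isB.lipschitz_of_le (d := 2 * C + 1) (u := u - z) (v := v - z)
      (u' := u - 1 - ρ w) (v' := v - ρ w) (by linarith) (by linarith) (by linarith)
      (by linarith) hα (by
        have h5 : |u - z - (u - 1 - ρ w)| ≤ C + 1 := abs_le.2 ⟨by linarith, by linarith⟩
        have h6 : |v - z - (v - ρ w)| ≤ C := abs_le.2 ⟨by linarith, by linarith⟩
        linarith)
    have h7 : e (u - 1) ≤ e u := d.err.mono (mem_Ici.2 (by linarith)) (mem_Ici.2 (by linarith))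
      (by linarith)
    linarith

/-- Double counting: if all the cylinders in `W` lie in a ball of radius `2 ^ (-v)`, then each of
them needs many balls of radius `2 ^ (-u)`, while each of these balls meets few of the cylinders. -/
lemma ncard_mul_le [Finite I] (d : IsBranchingModel f F Λ ρ ψ h α A δ C e)
    {u v t c : ℝ} (ht : 0 ≤ t) (htu : t ≤ u) {x : X} (hx : x ∈ Λ) {W : Set (List I)} (hW : W ⊆ cutSet ρ t)
    (hball : ∀ w ∈ W, wordMap f w '' F ⊆ Metric.ball x ((2 : ℝ) ^ (-v)))
    (hc : ∀ w ∈ W, c ≤ br (wordMap f w '' F) (u - 1) (ρ w)) :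
    (W.ncard : ℝ) * (2 : ℝ) ^ c ≤ (2 : ℝ) ^ (br Λ u v + e u) := by
  classical
  obtain ⟨T, hTΛ, hT, hcard⟩ := coverable_br d.attractor.isCompact d.attractor.nonempty u v x hx
  have hWf : W.Finite := (d.weight.finite_cutSet t).subset hW
  let r : List I → X → Prop := fun w y =>
    (wordMap f w '' F ∩ Metric.ball y ((2 : ℝ) ^ (-u))).Nonempty
  have h1 : ∀ w ∈ hWf.toFinset, (2 : ℝ) ^ c ≤ ((T.filter (r w)).card : ℝ) := by
    intro w hw
    have hw : w ∈ W := by simpa using hw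
    have hcov := coverable_recenter T (S := wordMap f w '' F) (r := (2 : ℝ) ^ (-u))
      (fun y hy => hT ⟨d.attractor.image_condensation_subset w hy, hball w hw hy⟩)
      (T.filter (r w)) fun y hy hne => Finset.mem_filter.2 ⟨hy, hne⟩
    have hpos : (0 : ℝ) < (T.filter (r w)).card :=
      one_pos.trans_le (hcov.one_le (d.nonempty.image _))
    have hbr : br (wordMap f w '' F) (u - 1) (ρ w) ≤ Real.logb 2 (T.filter (r w)).card := by
      refine (br_le_iff (d.isCompact.image (d.continuous w)) (d.nonempty.image _)).2 fun y _ => ?_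
      rw [Real.rpow_logb two_pos (by norm_num) hpos, ← two_mul_rpow_neg]
      exact hcov.mono le_rfl inter_subset_left le_rfl le_rfl
    exact (Real.le_logb_iff_rpow_le one_lt_two hpos).1 ((hc w hw).trans hbr)
  have h2 : ∀ y ∈ T, ((hWf.toFinset.filter fun w => r w y).card : ℝ) ≤ (2 : ℝ) ^ e u := by
    intro y _
    have hsub : ((hWf.toFinset.filter fun w => r w y : Finset (List I)) : Set (List I)) ⊆
        cutSetNear f ρ y t := by
      intro w hw
      simp only [Finset.coe_filter, Finite.mem_toFinset, mem_ofPred_eq] at hw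
      exact ⟨hW hw.1, hw.2.mono (inter_subset_inter (image_subset_range _ _)
        (Metric.ball_subset_ball (Real.rpow_le_rpow_of_exponent_le one_le_two (by linarith))))⟩
    have h3 := ncard_le_ncard hsub (finite_cutSetNear d.weight y t)
    rw [ncard_coe_finset] at h3
    exact le_trans (by exact_mod_cast h3) ((d.near t ht y).trans
      (Real.rpow_le_rpow_of_exponent_le one_le_two
        (d.err.mono (mem_Ici.2 ht) (mem_Ici.2 (ht.trans htu)) htu)))
  have h3 : (∑ w ∈ hWf.toFinset, ((T.filter (r w)).card : ℝ)) =
      ∑ y ∈ T, ((hWf.toFinset.filter fun w => r w y).card : ℝ) := by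
    exact_mod_cast Finset.sum_card_bipartiteAbove_eq_sum_card_bipartiteBelow r
  calc (W.ncard : ℝ) * (2 : ℝ) ^ c = ∑ w ∈ hWf.toFinset, (2 : ℝ) ^ c := by
        rw [Finset.sum_const, nsmul_eq_mul, ncard_eq_toFinset_card W hWf]
    _ ≤ ∑ y ∈ T, ((hWf.toFinset.filter fun w => r w y).card : ℝ) := by
        rw [← h3]
        exact Finset.sum_le_sum h1
    _ ≤ ∑ y ∈ T, (2 : ℝ) ^ e u := Finset.sum_le_sum h2
    _ = T.card * (2 : ℝ) ^ e u := by rw [Finset.sum_const, nsmul_eq_mul]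
    _ ≤ (2 : ℝ) ^ br Λ u v * (2 : ℝ) ^ e u := by gcongr
    _ = _ := by rw [Real.rpow_add two_pos]

/-- Inside a ball of radius `2 ^ (-v)` there are about `2 ^ (h (z - v))` images of the condensation
set under words of weight about `z`; each of them contributes `ψ (u - z, 0)`. -/
lemma le_br_of_ge [Finite I] [Nonempty I] (d : IsBranchingModel f F Λ ρ ψ h α A δ C e)
    {u v z : ℝ} (hv : 0 ≤ v) (hvz : v ≤ z) (hzu : z ≤ u) :
    h * (z - v) + ψ ⟨(u - z, 0), le_refl 0, sub_nonneg.2 hzu⟩ ≤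
      br Λ u v + (h * (2 * C + 2 + A + e u) + 3 * e u + α * (2 * C + 1)) := by
  have hh := d.exponent_nonneg
  have hα : 0 ≤ α := hh.trans d.exponent_le
  have hA := d.weight.defect_nonneg
  have hC : 0 < C := by linarith [d.weight.step_le, d.weight.step_pos]
  have hu : 0 ≤ u := by linarith
  have heu := d.err.nonneg u hu
  have hmono : ∀ s, 0 ≤ s → s ≤ u → e s ≤ e u := fun s hs hsu =>
    d.err.mono (mem_Ici.2 hs) (mem_Ici.2 hu) hsu
  set L := 2 * C + 2 + A + e u with hL
  have hαC : 0 ≤ α * (2 * C + 1) := by positivity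
  rcases le_or_gt (z - v) L with h1 | h1
  · have h2 := d.le_br_of_le hv le_rfl (hvz.trans hzu)
    simp only [sub_self] at h2
    have h3 := d.isB.mono_left 0 (u - z) (u - v) le_rfl (by linarith) (by linarith)
    have h4 := mul_le_mul_of_nonneg_left h1 hh
    linarith
  -- a word of weight about `v`, so long that its cylinder has diameter less than `2 ^ (-v)`
  obtain ⟨w₀, hw₀⟩ := d.weight.cutSet_nonempty (u := v + 1 + e u) (by linarith)
  have hρ1 := hw₀.2
  have hρ2 := d.weight.lt_add_of_mem_cutSet hw₀
  obtain ⟨y, hy⟩ := d.nonempty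
  have hball : range (wordMap f w₀) ⊆ Metric.ball (wordMap f w₀ y) ((2 : ℝ) ^ (-v)) := by
    rintro _ ⟨y', rfl⟩
    refine (d.diam w₀ y' y).trans_lt (Real.rpow_lt_rpow_of_exponent_lt one_lt_two ?_)
    have := hmono (ρ w₀) (by linarith) (by linarith)
    linarith
  have hext := d.weight.ncard_cutSet_le_ncard_extensions (w₀ := w₀) (t := z - v - L)
    (u := z - C - 1) (by linarith) (by linarith)
  have hcount := d.ncard_mul_le (u := u) (v := v) (t := z - C - 1)
    (c := ψ ⟨(u - z, 0), le_refl 0, sub_nonneg.2 hzu⟩ - e u) (by linarith) (by linarith)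
    (x := wordMap f w₀ y) (d.attractor.image_condensation_subset w₀ ⟨y, hy, rfl⟩)
    (W := {w | w ∈ cutSet ρ (z - C - 1) ∧ w₀ <+: w}) (fun w hw => hw.1)
    (fun w hw => (image_subset_range _ _).trans ((range_wordMap_subset hw.2).trans hball))
    (fun w hw => by
      have h2 := d.weight.lt_add_of_mem_cutSet hw.1
      have h3 := d.weight.nonneg w
      have h4 := (abs_le.1 (d.piece w (u - 1 - ρ w) 0 le_rfl (by linarith))).1
      simp only [sub_add_cancel, zero_add] at h4
      have h5 := d.isB.mono_left 0 (u - z) (u - 1 - ρ w) le_rfl (by linarith) (by linarith)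
      have h6 := hmono (u - 1) (by linarith) (by linarith)
      linarith)
  have hle := d.le_card (z - v - L) (by linarith)
  have hfinal : (2 : ℝ) ^ (h * (z - v - L) - e (z - v - L) +
      (ψ ⟨(u - z, 0), le_refl 0, sub_nonneg.2 hzu⟩ - e u)) ≤ (2 : ℝ) ^ (br Λ u v + e u) := by
    rw [Real.rpow_add two_pos]
    refine le_trans ?_ hcount
    gcongr
    exact hle.trans (by exact_mod_cast hext)
  rw [Real.rpow_le_rpow_left_iff one_lt_two] at hfinal
  have := hmono (z - v - L) (by linarith) (by linarith)
  linarith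

/-! ### The upper bound -/

/-- The covering number of the part of `f_w(F)` in a ball of radius `2 ^ (-v)`: the weight `ρ w` is
one of the shifts competing for `Φ_h(ψ)(u, v)`. -/
lemma coverable_piece [Nonempty I] (d : IsBranchingModel f F Λ ρ ψ h α A δ C e)
    {u v : ℝ} (hv : 0 ≤ v) (hvu : v ≤ u) {w : List I} (hw : ρ w ≤ u) (x : X) :
    Coverable Λ (wordMap f w '' F ∩ Metric.ball x ((2 : ℝ) ^ (-v))) ((2 : ℝ) ^ (-u))
      ((2 : ℝ) ^ (Phi h ψ ⟨(u, v), hv, hvu⟩ - h * max (ρ w - v) 0 + 2 * e u)) := by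
  have hs := d.weight.nonneg w
  have hC : 0 < C := by linarith [d.weight.step_le, d.weight.step_pos, d.weight.defect_nonneg]
  set S := wordMap f w '' F ∩ Metric.ball x ((2 : ℝ) ^ (-v)) with hS
  -- it suffices to cover at the larger of the scales of the ball and of the cylinder, and to
  -- pass from there to the scale `2 ^ (-u)`
  have key : ∀ m (hm : ρ w ≤ m) (hmu : m ≤ u),
      Coverable S S ((2 : ℝ) ^ (-m)) ((2 : ℝ) ^ e m) →
      ψ ⟨(u - ρ w, m - ρ w), sub_nonneg.2 hm, sub_le_sub_right hmu _⟩ ≤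
        Phi h ψ ⟨(u, v), hv, hvu⟩ - h * max (ρ w - v) 0 →
      Coverable Λ S ((2 : ℝ) ^ (-u))
        ((2 : ℝ) ^ (Phi h ψ ⟨(u, v), hv, hvu⟩ - h * max (ρ w - v) 0 + 2 * e u)) := by
    intro m hm hmu hcov hle
    have h1 := (abs_le.1 (d.piece w (u - ρ w) (m - ρ w) (by linarith) (by linarith))).2
    simp only [sub_add_cancel] at h1
    have h2 : e m ≤ e u := d.err.mono (mem_Ici.2 (by linarith)) (mem_Ici.2 (by linarith)) hmu
    refine ((hcov.mono (A' := wordMap f w '' F) inter_subset_left le_rfl le_rfl le_rfl).trans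
      (by positivity) inter_subset_left (coverable_br (d.isCompact.image (d.continuous w))
        (d.nonempty.image _) u m)).mono (d.attractor.image_condensation_subset w) le_rfl le_rfl ?_
    rw [← Real.rpow_add two_pos]
    exact Real.rpow_le_rpow_of_exponent_le one_le_two (by linarith)
  rcases le_total v (ρ w) with h1 | h1
  · refine key (ρ w) le_rfl hw (d.small _ hs w le_rfl (by linarith) S
      (inter_subset_left.trans (image_subset_range _ _))) ?_
    rw [max_eq_left (by linarith)]
    have := d.isB.le_Phi_of_ge h hv h1 hw
    simp only [sub_self]
    linarith
  · refine key v h1 hvu (d.small_ball v hv x S inter_subset_right) ?_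
    rw [max_eq_right (by linarith)]
    have := d.isB.le_Phi_of_le h hs h1 hvu
    linarith

/-- The upper bound. The part of the attractor in a ball of radius `2 ^ (-v)` is covered by the image
of the condensation set under the empty word, the images under the words of the cut sets at the
levels `k δ ≤ u`, and the cylinders of level `u`. The count of the words of each level meeting the
ball is exactly compensated by the term `h * max (ρ w - v) 0` of `coverable_piece`. -/
theorem br_le [Finite I] [Nonempty I] (d : IsBranchingModel f F Λ ρ ψ h α A δ C e)
    {u v : ℝ} (hv : 0 ≤ v) (hvu : v ≤ u) (hu : 0 < u) :
    br Λ u v ≤ Phi h ψ ⟨(u, v), hv, hvu⟩ + 4 * e u + Real.logb 2 (u / δ + 2) := by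
  have hδ := d.weight.step_pos
  have hh := d.exponent_nonneg
  have hmono : ∀ s, 0 ≤ s → s ≤ u → e s ≤ e u := fun s hs hsu =>
    d.err.mono (mem_Ici.2 hs) (mem_Ici.2 hu.le) hsu
  have heu := d.err.nonneg u hu.le
  refine (br_le_iff d.attractor.isCompact d.attractor.nonempty).2 fun x hx => ?_
  set Bx := Metric.ball x ((2 : ℝ) ^ (-v)) with hB
  set N : ℝ := (2 : ℝ) ^ (Phi h ψ ⟨(u, v), hv, hvu⟩ + 4 * e u) with hN
  let V : ℝ → Set (List I) := fun t => {w | w ∈ cutSet ρ t ∧ (range (wordMap f w) ∩ Bx).Nonempty}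
  have hV : ∀ t, (V t).Finite := fun t => (d.weight.finite_cutSet t).subset fun w hw => hw.1
  have hVcard : ∀ t, 0 < t → t ≤ u →
      ((V t).ncard : ℝ) ≤ (2 : ℝ) ^ (h * max (t - v) 0 + 2 * e u) := fun t ht htu => by
    refine (ncard_near_le d.weight d.err d.err d.card_le d.near ht hv x).trans
      (Real.rpow_le_rpow_of_exponent_le one_le_two ?_)
    linarith [hmono t ht.le htu]
  have hroot : Coverable Λ (wordMap f [] '' F ∩ Bx) ((2 : ℝ) ^ (-u)) N := by
    refine (d.coverable_piece hv hvu (w := []) (by rw [d.weight.nil]; exact hu.le) x).mono le_rfl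
      le_rfl le_rfl (Real.rpow_le_rpow_of_exponent_le one_le_two ?_)
    have : 0 ≤ h * max (ρ [] - v) 0 := by positivity
    linarith
  have hlevel : ∀ t, 0 < t → t ≤ u → Coverable Λ
      (⋃ w ∈ {w | w ∈ V t ∧ ρ w ≤ u}, wordMap f w '' F ∩ Bx) ((2 : ℝ) ^ (-u)) N := by
    intro t ht htu
    have hfin : {w | w ∈ V t ∧ ρ w ≤ u}.Finite := (hV t).subset fun w hw => hw.1
    refine (coverable_biUnion_of_ncard_le hfin (a := h * max (t - v) 0 + 2 * e u)
      (b := Phi h ψ ⟨(u, v), hv, hvu⟩ - h * max (t - v) 0 + 2 * e u) ?_ ?_).mono le_rfl le_rfl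
      le_rfl (Real.rpow_le_rpow_of_exponent_le one_le_two (by linarith))
    · refine le_trans ?_ (hVcard t ht htu)
      exact_mod_cast ncard_le_ncard (s := {w | w ∈ V t ∧ ρ w ≤ u}) (fun w hw => hw.1) (hV t)
    · intro w hw
      refine (d.coverable_piece hv hvu hw.2 x).mono le_rfl le_rfl le_rfl
        (Real.rpow_le_rpow_of_exponent_le one_le_two ?_)
      have : h * max (t - v) 0 ≤ h * max (ρ w - v) 0 :=
        mul_le_mul_of_nonneg_left (max_le_max_right _ (sub_le_sub_right hw.1.1.2 v)) hh
      linarith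
  have hcyl : Coverable Λ (⋃ w ∈ V u, wordMap f w '' Λ ∩ Bx) ((2 : ℝ) ^ (-u)) N := by
    refine (coverable_biUnion_of_ncard_le (hV u) (hVcard u hu le_rfl) (b := e u) fun w hw => ?_).mono
      le_rfl le_rfl le_rfl (Real.rpow_le_rpow_of_exponent_le one_le_two ?_)
    · exact (d.small u hu.le w hw.1.2 (d.weight.lt_add_of_mem_cutSet hw.1).le _
        (inter_subset_left.trans (image_subset_range _ _))).mono
        (inter_subset_left.trans (d.attractor.image_subset w)) le_rfl le_rfl le_rfl
    · have h1 := d.isB.le_Phi_of_ge h hv hvu le_rfl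
      have h2 := d.isB.nonneg ⟨(u - u, 0), le_refl 0, sub_nonneg.2 le_rfl⟩
      rw [max_eq_left (by linarith)]
      linarith
  have hlevels := Coverable.biUnion (Finset.Icc 1 ⌊u / δ⌋₊)
    (S := fun k : ℕ => ⋃ w ∈ {w | w ∈ V (k * δ) ∧ ρ w ≤ u}, wordMap f w '' F ∩ Bx) fun k hk => by
      rw [Finset.mem_Icc] at hk
      have hk0 : (0 : ℝ) < k := by exact_mod_cast hk.1
      refine hlevel (k * δ) (by positivity) ?_
      rw [← le_div_iff₀ hδ]
      exact (Nat.le_floor_iff (by positivity)).1 hk.2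
  refine ((hroot.union hlevels).union hcyl).mono le_rfl ?_ le_rfl ?_
  · rintro y ⟨hyΛ, hyB⟩
    rcases d.attractor.exists_piece d.weight hu hyΛ with ⟨w, hw, hy⟩ | ⟨w, hw, hy⟩
    · refine Or.inl ?_
      rcases eq_or_ne w [] with rfl | hne
      · exact Or.inl ⟨hy, hyB⟩
      -- a non-empty word belongs to the cut set at the last multiple of `δ` before its weight,
      -- as each letter adds at least `δ`
      refine Or.inr ?_
      have h1 := d.weight.dropLast_add_le hne
      have h2 := d.weight.nonneg w.dropLast
      have h3 := Nat.floor_le (div_nonneg (d.weight.nonneg w) hδ.le)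
      have h4 := Nat.lt_floor_add_one (ρ w / δ)
      rw [le_div_iff₀ hδ] at h3
      rw [div_lt_iff₀ hδ] at h4
      refine mem_biUnion (x := ⌊ρ w / δ⌋₊) ?_ (mem_biUnion (x := w) ⟨⟨⟨?_, h3⟩, ?_⟩, hw.le⟩
        ⟨hy, hyB⟩)
      · simp only [Finset.coe_Icc, mem_Icc]
        refine ⟨Nat.le_floor ?_, Nat.floor_le_floor (by gcongr)⟩
        rw [le_div_iff₀ hδ]
        push_cast
        linarith
      · linarith
      · exact ⟨y, image_subset_range _ _ hy, hyB⟩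
    · exact Or.inr (mem_biUnion (show w ∈ V u from ⟨hw, y, image_subset_range _ _ hy, hyB⟩)
        ⟨hy, hyB⟩)
  · have hN0 : 0 < N := by positivity
    have h1 := Nat.floor_le (show 0 ≤ u / δ by positivity)
    rw [Real.rpow_add two_pos, Real.rpow_logb two_pos (by norm_num) (by positivity), Nat.card_Icc,
      ← hN]
    simp only [add_tsub_cancel_right]
    nlinarith

end IsBranchingModel

/-! ### Assembling the estimates -/

lemma exists_isErrorFunction_logb {δ : ℝ} (hδ : 0 < δ) :
    ∃ e, IsErrorFunction e ∧ ∀ u, 0 ≤ u → Real.logb 2 (u / δ + 2) ≤ e u := by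
  have key := exists_isErrorFunction (ι := {u : ℝ // 0 ≤ u})
    (fun u b => Real.logb 2 (u / δ + 2) ≤ b) (fun u => u.1) (fun u => u.2)
    (fun u b b' hb h => h.trans hb)
  refine (key ?_).imp fun e he => ⟨he.1, fun u hu => he.2 ⟨u, hu⟩⟩
  intro ε hε
  have hl : 0 < Real.log 2 := Real.log_pos one_lt_two
  set M : ℝ := max 2 (1 / (δ * (ε * Real.log 2))) with hM
  have hM2 : 2 ≤ M := le_max_left _ _
  have hM1 : 1 ≤ M * (δ * (ε * Real.log 2)) := by
    rw [← div_le_iff₀ (by positivity)]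
    exact le_max_right _ _
  refine ⟨Real.logb 2 M, fun ⟨u, hu⟩ => ?_⟩
  have hpos : 0 < u / δ + 2 := by positivity
  rw [Real.logb_le_iff_le_rpow one_lt_two hpos, Real.rpow_add two_pos,
    Real.rpow_logb two_pos (by norm_num) (by linarith), Real.rpow_def_of_pos two_pos]
  have h1 := Real.add_one_le_exp (Real.log 2 * (ε * u))
  have h2 : u / δ ≤ Real.log 2 * (ε * u) * M := by
    rw [div_le_iff₀ hδ]
    nlinarith
  nlinarith

section

variable {X I : Type*} [MetricSpace X] {f : I → X → X} {F Λ : Set X} {ρ : List I → ℝ}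

theorem exists_isBranchingModel [CompactSpace X] [Nonempty X] {ψ : Delta → ℝ} {h α A δ C : ℝ}
    (hX : HasQuasiAssouadDim X α) (hf : ∀ i, ∃ K, ContractingWith K (f i))
    (hFne : F.Nonempty) (hF : IsCompact F) (hΛ : IsInhomogeneousAttractor f F Λ)
    (hρ : IsMinimallyDistorting f F ρ) (hC : 0 ≤ C) (hw : IsWordWeight ρ A δ C) (hh : 0 ≤ h)
    (hhα : h ≤ α)
    {e₁ e₂ : ℝ → ℝ} (he₁ : IsErrorFunction e₁) (he₂ : IsErrorFunction e₂)
    (hnear : ∀ u, 0 ≤ u → ∀ x : X, ((cutSetNear f ρ x u).ncard : ℝ) ≤ (2 : ℝ) ^ e₁ u)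
    (hcard : ∀ t, 0 < t → ((cutSet ρ t).ncard : ℝ) ≤ (2 : ℝ) ^ (h * t + e₂ t) ∧
      (2 : ℝ) ^ (h * t - e₂ t) ≤ ((cutSet ρ t).ncard : ℝ))
    (hψ : IsB α ψ) (happ : IsApproxBranching F ψ) :
    ∃ e, IsBranchingModel f F Λ ρ ψ h α A δ C e := by
  obtain ⟨η, hη, hcon⟩ := hρ.contracting
  obtain ⟨η', hη', happ⟩ := happ
  obtain ⟨e₃, he₃, hcov⟩ := hX.exists_error_coverable (hη.comp_add hC)
  have hcont := continuous_wordMap fun i => (hf i).choose_spec.toLipschitzWith.continuous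
  have hle : ∀ {a b : ℝ}, a ≤ b → (2 : ℝ) ^ a ≤ (2 : ℝ) ^ b := fun hab =>
    Real.rpow_le_rpow_of_exponent_le one_le_two hab
  refine ⟨fun u => η u + η' u + (e₁ u + (e₂ u + e₃ u)),
    (hη.add hη').add (he₁.add (he₂.add he₃)), hw, hψ, hh, hhα, hcont, hF, hFne, hΛ,
    ?_, ?_, ?_, ?_, ?_, ?_, ?_⟩
  · intro w u v hv hvu
    have hu := hv.trans hvu
    have hz := hw.nonneg w
    have huz : 0 ≤ u + ρ w := by linarith
    have h1 := (hcon w).1.uniform u v hv hvu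
    have h2 := happ ⟨(u, v), hv, hvu⟩
    rw [← coe_br hF hFne, ← coe_br (hF.image (hcont w)) (hFne.image _), within_coe_iff] at h1
    dsimp only at h2
    rw [← coe_br hF hFne, within_coe_iff] at h2
    have h3 := hη'.mono (mem_Ici.2 hu) (mem_Ici.2 huz) (by linarith)
    have h4 := he₁.nonneg _ huz
    have h5 := he₂.nonneg _ huz
    have h6 := he₃.nonneg _ huz
    exact abs_le.2 ⟨by linarith [h1.2, h2.2], by linarith [h1.1, h2.1]⟩
  · intro w x y
    have hz := hw.nonneg w
    refine ((hcon w).2 x y).trans (hle ?_)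
    linarith [hη'.nonneg _ hz, he₁.nonneg _ hz, he₂.nonneg _ hz, he₃.nonneg _ hz]
  · intro t ht
    refine (hcard t ht).1.trans (hle ?_)
    linarith [hη.nonneg _ ht.le, hη'.nonneg _ ht.le, he₁.nonneg _ ht.le, he₃.nonneg _ ht.le]
  · intro t ht
    refine (hle ?_).trans (hcard t ht).2
    linarith [hη.nonneg _ ht.le, hη'.nonneg _ ht.le, he₁.nonneg _ ht.le, he₃.nonneg _ ht.le]
  · intro u hu x
    refine (hnear u hu x).trans (hle ?_)
    linarith [hη.nonneg _ hu, hη'.nonneg _ hu, he₂.nonneg _ hu, he₃.nonneg _ hu]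
  · intro m hm w hmw hwm S hS
    obtain ⟨y⟩ := ‹Nonempty X›
    refine (hcov m hm (wordMap f w y) S (hS.trans ?_)).mono le_rfl le_rfl le_rfl (hle ?_)
    · rintro _ ⟨y', rfl⟩
      refine ((hcon w).2 y' y).trans_lt (Real.rpow_lt_rpow_of_exponent_lt one_lt_two ?_)
      have := hη.mono (mem_Ici.2 (hw.nonneg w)) (mem_Ici.2 (by linarith : 0 ≤ m + C)) hwm
      linarith
    · linarith [hη.nonneg _ hm, hη'.nonneg _ hm, he₁.nonneg _ hm, he₂.nonneg _ hm]
  · intro m hm x S hS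
    refine (hcov m hm x S (hS.trans (Metric.ball_subset_ball (hle ?_)))).mono le_rfl le_rfl
      le_rfl (hle ?_)
    · linarith [hη.nonneg (m + C) (by linarith)]
    · linarith [hη.nonneg _ hm, hη'.nonneg _ hm, he₁.nonneg _ hm, he₂.nonneg _ hm]

theorem IsBranchingModel.isApproxBranching [Finite I] [Nonempty I] {ψ : Delta → ℝ}
    {h α A δ C : ℝ} {e : ℝ → ℝ} (d : IsBranchingModel f F Λ ρ ψ h α A δ C e) :
    IsApproxBranching Λ (Phi h ψ) := by
  have hh := d.exponent_nonneg
  have hα : 0 ≤ α := hh.trans d.exponent_le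
  have hA := d.weight.defect_nonneg
  have hC : 0 < C := by linarith [d.weight.step_le, d.weight.step_pos]
  obtain ⟨e', he', hlog⟩ := exists_isErrorFunction_logb d.weight.step_pos
  have h00 := br_nonneg d.attractor.nonempty 0 0
  refine ⟨fun u => (h * (2 * C + 2 + A + e u) + 4 * e u) + (e' u + (α * (2 * C + 1) + br Λ 0 0)),
    ((((IsErrorFunction.const (by positivity)).add d.err).const_mul hh).add
      (d.err.const_mul (by norm_num))).add
      (he'.add (.const (by positivity))), ?_⟩
  rintro ⟨⟨u, v⟩, hv, hvu⟩
  dsimp only at hv hvu ⊢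
  have hu : 0 ≤ u := hv.trans hvu
  have heu := d.err.nonneg u hu
  have heu' := he'.nonneg u hu
  have hαC : 0 ≤ α * (2 * C + 1) := by positivity
  have hhL : 0 ≤ h * (2 * C + 2 + A + e u) := by positivity
  rw [← coe_br d.attractor.isCompact d.attractor.nonempty, within_coe_iff]
  constructor
  · rcases hu.eq_or_lt with rfl | hu
    · obtain rfl : v = 0 := le_antisymm hvu hv
      have := (d.isB.nonneg _).trans (d.isB.le_Phi h ⟨(0, 0), hv, hvu⟩)
      linarith
    · have h1 := d.br_le hv hvu hu
      have h2 := hlog u hu.le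
      linarith
  · refine d.isB.Phi_le h hv hvu (fun z hz hzv => ?_) fun z hvz hzu => ?_
    · have := d.le_br_of_le hz hzv hvu
      linarith
    · have := d.le_br_of_ge hv hvz hzu
      linarith

end

end TwoScaleBranching


theorem theoremD :
    (∀ α h : ℝ, 0 ≤ h → h ≤ α →
      (∀ β ∈ B α,
        (∀ p, IsGreatest (PhiValues h β p) (Phi h β p)) ∧
        Phi h β ∈ Bbar h α ∧
        IsLeast {ξ | ξ ∈ Bbar h α ∧ β ≤ ξ} (Phi h β) ∧
        (∀ p, IsGLB {t | ∃ ξ ∈ Bbar h α, β ≤ ξ ∧ t = ξ p} (Phi h β p)) ∧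
        Phi h (Phi h β) = Phi h β) ∧
      SurjOn (Phi h) (B α) (Bbar h α) ∧
      (∀ ξ ∈ Bbar h α, Phi h ξ = ξ)) ∧
    (∀ (X : Type*) [MetricSpace X] [CompactSpace X] (I : Type*) [Finite I] [Nonempty I]
      (α : ℝ) (f : I → X → X) (F Λ : Set X) (ρ : List I → ℝ),
      HasQuasiAssouadDim X α →
      (∀ i, ∃ K, ContractingWith K (f i)) →
      F.Nonempty → IsCompact F →
      IsInhomogeneousAttractor f F Λ →
      IsMinimallyDistorting f F ρ →
      IsAsymptoticallyBounded f ρ →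
      ∃ h : ℝ, IsCriticalExponent ρ h ∧ 0 ≤ h ∧ h ≤ α ∧
        ∀ ψ ∈ B α, IsApproxBranching F ψ → IsApproxBranching Λ (Phi h ψ)) := by
  constructor
  · intro α h hh hhα
    refine ⟨fun β hβ => ?_, fun ξ hξ => ⟨ξ, hξ.1, Phi_eq_self_of_mem_Bbar hξ⟩,
      fun ξ hξ => Phi_eq_self_of_mem_Bbar hξ⟩
    have hβ : IsB α β := hβ
    have hmem := hβ.Phi_mem_Bbar hh hhα
    refine ⟨hβ.isGreatest_Phi h, hmem, ⟨⟨hmem, hβ.le_Phi h⟩, fun ξ hξ =>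
      hβ.Phi_le_of_mem_Bbar hξ.1 hξ.2⟩, fun p => ?_, Phi_eq_self_of_mem_Bbar hmem⟩
    refine IsLeast.isGLB ⟨⟨_, hmem, hβ.le_Phi h, rfl⟩, ?_⟩
    rintro _ ⟨ξ, hξ, hle, rfl⟩
    exact hβ.Phi_le_of_mem_Bbar hξ hle p
  · intro X _ _ I _ _ α f F Λ ρ hX hf hFne hF hΛ hρ hb
    have : Nonempty X := ⟨hFne.some⟩
    obtain ⟨A, δ, C, hw⟩ := hρ.exists_isWordWeight
    have hC : 0 ≤ C := by linarith [hw.step_le, hw.step_pos, hw.defect_nonneg]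
    obtain ⟨h, hcrit, hh, hhα, e₂, he₂, hcard⟩ := exists_criticalExponent hX hw hb
    obtain ⟨e₁, he₁, hnear⟩ := hb.exists_error hw
    refine ⟨h, hcrit, hh, hhα, fun ψ hψ happ => ?_⟩
    obtain ⟨e, d⟩ := exists_isBranchingModel hX hf hFne hF hΛ hρ hC hw hh hhα he₁ he₂ hnear
      hcard hψ happ
    exact d.isApproxBranching
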